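/- Let $E\subset\mathbb R^3$ be an ovaloid, i.e. a closed (compact, connected, embedded, without boundary) $C^2$-surface with positive Gaussian curvature $K=k_1k_2$, and suppose that the origin $o$ lies in the open region $E^*$ bounded by $E$. Let $H=\tfrac12(k_1+k_2)$ be the mean curvature of $E$ with respect to the outward unit normal $N$, with the sign convention that the principal curvatures $k_1,k_2$ are the eigenvalues of $dN$ (so $H=1/R$ for a sphere of radius $R$), and let $dE$ be the area element. Let $P(w)=\max_{x\in E}\langle x,w\rangle$, $w\in S^2$, be the support function of $E$ with respect to $o$, let $\overset{o}{E}=\{P(w)w : w\in S^2\}$ be the pedal surface of $E$ with respect to $o$, and let $\overset{o}{E}{}^*$ be the region it bounds. Then the total mean curvature of $E$ is $$M(E)=\int_E H\,dE=\int_{\overset{o}{E}{}^*}\frac{dy}{\|y\|^2},$$ both integrals being finite. -/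

import Mathlib

open MeasureTheory Filter Topology Set
open scoped RealInnerProductSpace

noncomputable section

namespace Ovaloid

/-- Euclidean three-space. -/
abbrev E3 : Type := EuclideanSpace ℝ (Fin 3)

/-- Euclidean plane, the domain of local parametrizations. -/
abbrev E2 : Type := EuclideanSpace ℝ (Fin 2)

/-- `φ : U → E` is a regular local parametrization of class `C²` of the set `E`: an injective `C²`
immersion on the open set `U`, which is a homeomorphism onto a relatively open subset of `E`. -/
structure IsLocalParam (E : Set E3) (U : Set E2) (φ : E2 → E3) : Prop where
  isOpen : IsOpen U
  contDiffOn : ContDiffOn ℝ 2 φ U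
  injOn : InjOn φ U
  immersion : ∀ u ∈ U, Function.Injective (fderiv ℝ φ u)
  open_image : ∀ W ⊆ U, IsOpen W → ∃ V : Set E3, IsOpen V ∧ φ '' W = E ∩ V

/-- A closed `C²`-surface in space: compact, connected, without boundary, and around each of its
points given by a regular local parametrization of class `C²`. -/
structure IsClosedC2Surface (E : Set E3) : Prop where
  isCompact : IsCompact E
  isConnected : IsConnected E
  exists_localParam : ∀ x ∈ E, ∃ (U : Set E2) (φ : E2 → E3), IsLocalParam E U φ ∧ x ∈ φ '' U

/-- The (open) region `A*` bounded by a closed surface `A`: the points off `A` whose connected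
component in the complement of `A` is bounded. -/
def region (A : Set E3) : Set E3 :=
  {x | x ∉ A ∧ Bornology.IsBounded (connectedComponentIn Aᶜ x)}

/-- The tangent plane of `E` at `x`, as a linear subspace. -/
def tangentPlane (E : Set E3) (x : E3) : Submodule ℝ E3 :=
  Submodule.span ℝ (tangentConeAt ℝ E x)

/-- `ν` is a unit vector orthogonal to `E` at `x` that points out of the region bounded by `E`. -/
def IsOutwardNormal (E : Set E3) (x ν : E3) : Prop :=
  ‖ν‖ = 1 ∧ (∀ v ∈ tangentPlane E x, ⟪v, ν⟫ = 0) ∧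
    ∀ᶠ t : ℝ in 𝓝[>] 0, x - t • ν ∈ region E ∧ x + t • ν ∉ region E

open Classical in
/-- The outward unit normal field `N` of a closed surface `E` (with value `0` off `E`). -/
def outwardNormal (E : Set E3) (x : E3) : E3 :=
  if h : x ∈ E ∧ ∃ ν, IsOutwardNormal E x ν then h.2.choose else 0

/-- The differential of the outward unit normal field, as an endomorphism of the tangent plane.
Its eigenvalues are the principal curvatures `k₁`, `k₂`, with the sign for which they are `1 / R` on
a sphere of radius `R`. The differential of a unit normal field maps the tangent plane to itself;
the orthogonal projection only adjusts the codomain. -/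
def weingarten (E : Set E3) (x : E3) : tangentPlane E x →ₗ[ℝ] tangentPlane E x :=
  ((tangentPlane E x).orthogonalProjectionOnto ∘L fderivWithin ℝ (outwardNormal E) E x ∘L
    (tangentPlane E x).subtypeL).toLinearMap

/-- The Gaussian curvature `K = k₁ k₂`. -/
def gaussianCurvature (E : Set E3) (x : E3) : ℝ :=
  LinearMap.det (weingarten E x)

/-- The mean curvature `H = (k₁ + k₂) / 2`. -/
def meanCurvature (E : Set E3) (x : E3) : ℝ :=
  LinearMap.trace ℝ (tangentPlane E x) (weingarten E x) / 2

/-- An ovaloid: a closed `C²`-surface with positive Gaussian curvature. -/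
structure IsOvaloid (E : Set E3) : Prop extends IsClosedC2Surface E where
  gaussianCurvature_pos : ∀ x ∈ E, 0 < gaussianCurvature E x

/-- The support function of `E` with respect to the point `m`. -/
def support (E : Set E3) (m w : E3) : ℝ :=
  sSup ((fun x => ⟪x - m, w⟫) '' E)

/-- The pedal surface of `E` with respect to `m`: the image of the unit sphere under
`w ↦ P(w) w + m`, where `P` is the support function of `E` with respect to `m`. -/
def pedalSurface (E : Set E3) (m : E3) : Set E3 :=
  (fun w => support E m w • w + m) '' Metric.sphere 0 1

end Ovaloid

end

/-!
Let `N` be the outward unit normal of the ovaloid `E`, `P` its support function, and `σ` the area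
measure of the unit sphere. Both sides of the formula are equal to `∫ P dσ`.

*The Gauss map is a bijection onto the sphere.* Every unit vector is a normal, at a point of maximal
height (`exists_outwardNormal_eq`). Since `K > 0`, the differential of `N` is definite at every
point; a maximum of the height shows that it is positive there, and connectedness of `E` carries the
sign over to all points (`inner_normalDeriv_pos`). So near each of its points `E` lies strictly on
one side of its tangent plane, and a component of the region bounded by `E` is convex
(`convex_component`), because it is locally convex and connected. By connectedness again, all of `E`
lies on the boundary of one such component, so it lies strictly on one side of each tangent plane
(`inner_sub_neg`), and `N` is injective on `E`. Its inverse `X` satisfies `P(w) = ⟪X w, w⟫`, and it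
is `C¹` when extended to be constant on rays, by the inverse function theorem for the cone
`(r, u) ↦ r N(φ u)` over a chart `φ` (`contDiffAt_gaussInvExt`). The differential of this extension
vanishes in the radial direction and inverts `dN` on the tangent plane; its trace at `w` is therefore
`1/k₁ + 1/k₂ = 2H/K`, evaluated at `X w` (`gaussianCurvature_mul_trace`).

*The area of the Gauss image is `K dE`* (`gaussMeasure_eq`). The two measures are compared directly.
Near a point, a chart changes the Hausdorff measure by the Jacobian of its differential, up to a
factor close to `1`, because it is almost isometric to that differential. The change of variables
formula for the cone over the chart computes `σ` up to such a factor. The inequalities between the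
two measures that hold locally, up to a factor `c > 1`, add up to global ones
(`measure_le_of_locally_le`), and `c` tends to `1`.

*Integration.* These facts give `∫ H dE = ½ ∫ (2H/K) ∘ X dσ = ½ ∫ tr dX dσ`. For a field that is
constant on rays, the divergence theorem says `∫ tr dX dσ = 2 ∫ ⟪X w, w⟫ dσ`
(`integral_trace_fderiv_sphere`), which is `2 ∫ P dσ`. On the other side, `P > 0` because the origin
is inside, the region bounded by the pedal surface is `{r w : 0 ≤ r < P(w)}`
(`region_image_smul_sphere`), and in polar coordinates the factor `r²` cancels `1 / ‖y‖²`, which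
leaves `∫ P dσ` as well.
-/

namespace Ovaloid

section

/-! ### Local parametrizations -/

namespace IsLocalParam

variable {E : Set E3} {U : Set E2} {φ : E2 → E3} {u : E2}

theorem contDiffAt (h : IsLocalParam E U φ) (hu : u ∈ U) : ContDiffAt ℝ 2 φ u :=
  h.contDiffOn.contDiffAt (h.isOpen.mem_nhds hu)

theorem hasStrictFDerivAt (h : IsLocalParam E U φ) (hu : u ∈ U) :
    HasStrictFDerivAt φ (fderiv ℝ φ u) u :=
  (h.contDiffAt hu).hasStrictFDerivAt (by norm_num)

theorem hasFDerivAt (h : IsLocalParam E U φ) (hu : u ∈ U) :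
    HasFDerivAt φ (fderiv ℝ φ u) u :=
  (h.hasStrictFDerivAt hu).hasFDerivAt

theorem mapsTo (h : IsLocalParam E U φ) : MapsTo φ U E := by
  obtain ⟨V, -, hV⟩ := h.open_image U subset_rfl h.isOpen
  intro u hu
  exact (hV ▸ mem_image_of_mem φ hu : φ u ∈ E ∩ V).1

theorem image_mem_nhdsWithin (h : IsLocalParam E U φ) (hu : u ∈ U) {W : Set E2} (hW : W ∈ 𝓝 u) :
    φ '' (W ∩ U) ∈ 𝓝[E] (φ u) := by
  obtain ⟨O, hOW, hO, huO⟩ := mem_nhds_iff.1 hW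
  obtain ⟨V, hVo, hV⟩ := h.open_image (O ∩ U) inter_subset_right (hO.inter h.isOpen)
  have hx : φ u ∈ E ∩ V := hV ▸ mem_image_of_mem φ ⟨huO, hu⟩
  refine mem_of_superset (inter_mem_nhdsWithin E (hVo.mem_nhds hx.2)) ?_
  rw [← hV]
  exact image_mono (inter_subset_inter_left _ hOW)

theorem image_invFunOn (h : IsLocalParam E U φ) (hu : u ∈ U) :
    ∀ᶠ y in 𝓝[E] (φ u), Function.invFunOn φ U y ∈ U ∧ φ (Function.invFunOn φ U y) = y := by
  filter_upwards [h.image_mem_nhdsWithin hu univ_mem] with y hy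
  rw [univ_inter] at hy
  exact Function.invFunOn_pos hy

theorem tendsto_invFunOn (h : IsLocalParam E U φ) (hu : u ∈ U) :
    Tendsto (Function.invFunOn φ U) (𝓝[E] (φ u)) (𝓝 u) := by
  refine tendsto_def.2 fun W hW => ?_
  filter_upwards [h.image_mem_nhdsWithin hu hW] with y hy
  obtain ⟨v, ⟨hvW, hvU⟩, rfl⟩ := hy
  rwa [mem_preimage, h.injOn.leftInvOn_invFunOn hvU]

theorem exists_le_norm_fderiv (h : IsLocalParam E U φ) (hu : u ∈ U) :
    ∃ c > 0, ∀ a, c * ‖a‖ ≤ ‖fderiv ℝ φ u a‖ := by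
  obtain ⟨K, hK, hL⟩ := (fderiv ℝ φ u : E2 →ₗ[ℝ] E3).exists_antilipschitzWith
    (LinearMap.ker_eq_bot.2 (h.immersion u hu))
  refine ⟨(K : ℝ)⁻¹, by positivity, fun a => ?_⟩
  have h1 := hL.le_mul_dist a 0
  simp only [dist_zero_right, map_zero] at h1
  rw [inv_mul_le_iff₀ (by positivity)]
  exact h1

/-- Near a point the parametrization differs from its differential by a small fraction of the
distance between the image points. -/
theorem norm_sub_sub_le (h : IsLocalParam E U φ) (hu : u ∈ U) {ε : ℝ} (hε : 0 < ε) :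
    ∀ᶠ p in 𝓝 (u, u),
      ‖φ p.1 - φ p.2 - fderiv ℝ φ u (p.1 - p.2)‖ ≤ ε * ‖φ p.1 - φ p.2‖ := by
  obtain ⟨c, hc, hL⟩ := h.exists_le_norm_fderiv hu
  have h1 := (h.hasStrictFDerivAt hu).isLittleO.bound (c := min (c / 2) (ε * c / 2))
    (by positivity)
  filter_upwards [h1] with p hp
  have h2 := hL (p.1 - p.2)
  have h3 : ‖fderiv ℝ φ u (p.1 - p.2)‖ ≤ ‖φ p.1 - φ p.2‖
      + ‖φ p.1 - φ p.2 - fderiv ℝ φ u (p.1 - p.2)‖ := by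
    have := norm_sub_le (φ p.1 - φ p.2) (φ p.1 - φ p.2 - fderiv ℝ φ u (p.1 - p.2))
    simpa using this
  have h4 : ‖φ p.1 - φ p.2 - fderiv ℝ φ u (p.1 - p.2)‖ ≤ c / 2 * ‖p.1 - p.2‖ :=
    hp.trans (by gcongr; exact min_le_left _ _)
  have h5 : ‖φ p.1 - φ p.2 - fderiv ℝ φ u (p.1 - p.2)‖ ≤ ε * c / 2 * ‖p.1 - p.2‖ :=
    hp.trans (by gcongr; exact min_le_right _ _)
  have h6 : c / 2 * ‖p.1 - p.2‖ ≤ ‖φ p.1 - φ p.2‖ := by linarith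
  calc _ ≤ ε * (c / 2 * ‖p.1 - p.2‖) := by linarith
    _ ≤ _ := by gcongr

/-- Chords of the surface near a point are almost orthogonal to the normals at that point. -/
theorem abs_inner_sub_le (h : IsLocalParam E U φ) (hu : u ∈ U) {n : E3}
    (hn : ∀ a, ⟪fderiv ℝ φ u a, n⟫ = 0) {ε : ℝ} (hε : 0 < ε) :
    ∀ᶠ p in 𝓝[E] (φ u) ×ˢ 𝓝[E] (φ u), |⟪p.1 - p.2, n⟫| ≤ ε * ‖p.1 - p.2‖ := by
  have h1 := h.norm_sub_sub_le hu (ε := ε / (‖n‖ + 1)) (by positivity)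
  rw [nhds_prod_eq] at h1
  have h2 := ((h.tendsto_invFunOn hu).prodMap (h.tendsto_invFunOn hu)).eventually h1
  have h3 := (h.image_invFunOn hu)
  filter_upwards [h2, h3.prod_mk h3] with p hp hq
  simp only [Prod.map_fst, Prod.map_snd, hq.1.2, hq.2.2] at hp
  have h4 : ⟪p.1 - p.2, n⟫ = ⟪p.1 - p.2 - fderiv ℝ φ u
      (Function.invFunOn φ U p.1 - Function.invFunOn φ U p.2), n⟫ := by
    rw [inner_sub_left _ (fderiv ℝ φ u _), hn, sub_zero]
  rw [h4]
  calc _ ≤ _ := abs_real_inner_le_norm _ _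
    _ ≤ ε / (‖n‖ + 1) * ‖p.1 - p.2‖ * (‖n‖ + 1) := by gcongr; linarith
    _ = _ := by field_simp

theorem fderiv_mem_tangentConeAt (h : IsLocalParam E U φ) (hu : u ∈ U) (a : E2) :
    fderiv ℝ φ u a ∈ tangentConeAt ℝ E (φ u) := by
  have h1 := (h.hasFDerivAt hu).hasFDerivWithinAt (s := U)
  have h2 : a ∈ tangentConeAt ℝ U u := by
    rw [tangentConeAt_of_mem_nhds (h.isOpen.mem_nhds hu)]; trivial
  exact tangentConeAt_mono h.mapsTo.image_subset (h1.mapsTo_tangent_cone h2)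

/-- A vector orthogonal to all velocities of the parametrization is orthogonal to the tangent cone:
the linear form it defines has derivative zero along the surface. -/
theorem inner_eq_zero_of_mem_tangentConeAt (h : IsLocalParam E U φ) (hu : u ∈ U) {n : E3}
    (hn : ∀ a, ⟪fderiv ℝ φ u a, n⟫ = 0) {v : E3} (hv : v ∈ tangentConeAt ℝ E (φ u)) :
    ⟪v, n⟫ = 0 := by
  have h1 : HasFDerivWithinAt (fun y : E3 => ⟪n, y⟫) (innerSL ℝ n) E (φ u) :=
    (innerSL ℝ n).hasFDerivWithinAt
  have h2 : HasFDerivWithinAt (fun y : E3 => ⟪n, y⟫) (0 : E3 →L[ℝ] ℝ) E (φ u) := by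
    rw [hasFDerivWithinAt_iff_isLittleO, Asymptotics.isLittleO_iff]
    intro ε hε
    have h3 := h.abs_inner_sub_le hu hn hε
    have h4 : Tendsto (fun y => (y, φ u)) (𝓝[E] (φ u)) (𝓝[E] (φ u) ×ˢ 𝓝[E] (φ u)) :=
      tendsto_id.prodMk (tendsto_nhdsWithin_of_tendsto_nhds_of_eventually_within _
        tendsto_const_nhds (Eventually.of_forall fun _ => h.mapsTo hu))
    filter_upwards [h4.eventually h3] with y hy
    simpa [inner_sub_right, real_inner_comm, inner_sub_left] using hy
  have := h1.unique_on h2 hv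
  simpa [real_inner_comm] using this

theorem tangentPlane_eq (h : IsLocalParam E U φ) (hu : u ∈ U) :
    tangentPlane E (φ u) = LinearMap.range (fderiv ℝ φ u : E2 →ₗ[ℝ] E3) := by
  apply le_antisymm
  · refine Submodule.span_le.2 fun v hv => ?_
    rw [SetLike.mem_coe, ← Submodule.orthogonal_orthogonal
      (LinearMap.range (fderiv ℝ φ u : E2 →ₗ[ℝ] E3)), Submodule.mem_orthogonal]
    intro n hn
    rw [real_inner_comm]
    exact h.inner_eq_zero_of_mem_tangentConeAt hu
      (fun a => Submodule.inner_right_of_mem_orthogonal (LinearMap.mem_range_self _ a) hn) hv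
  · rintro _ ⟨a, rfl⟩
    exact Submodule.subset_span (h.fderiv_mem_tangentConeAt hu a)

theorem finrank_tangentPlane (h : IsLocalParam E U φ) (hu : u ∈ U) :
    Module.finrank ℝ (tangentPlane E (φ u)) = 2 := by
  rw [h.tangentPlane_eq hu, LinearMap.finrank_range_of_inj (h.immersion u hu)]
  simp

end IsLocalParam

end

section

/-! ### The outward unit normal field -/

variable {E : Set E3} {U : Set E2} {φ : E2 → E3} {u : E2} {x : E3}

/-- The derivative of the outward unit normal field along the surface, as an endomorphism of the
ambient space. Only its values on the tangent plane are meaningful. -/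
noncomputable abbrev normalDeriv (E : Set E3) (x : E3) : E3 →L[ℝ] E3 :=
  fderivWithin ℝ (outwardNormal E) E x

theorem IsClosedC2Surface.finrank_tangentPlane (hE : IsClosedC2Surface E) (hx : x ∈ E) :
    Module.finrank ℝ (tangentPlane E x) = 2 := by
  obtain ⟨U, φ, h, u, hu, rfl⟩ := hE.exists_localParam x hx
  exact h.finrank_tangentPlane hu

namespace IsOvaloid

theorem normalDeriv_ne_zero (hE : IsOvaloid E) (hx : x ∈ E) : normalDeriv E x ≠ 0 := by
  intro h0
  have h1 := hE.gaussianCurvature_pos x hx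
  have h2 : weingarten E x = 0 := by
    rw [weingarten, show fderivWithin ℝ (outwardNormal E) E x = 0 from h0]
    simp
  rw [gaussianCurvature, h2, LinearMap.det_zero, hE.finrank_tangentPlane hx] at h1
  norm_num at h1

/-- Positivity of the curvature excludes the junk value of the derivative, so that the normal field
is differentiable along the surface. -/
theorem differentiableWithinAt_outwardNormal (hE : IsOvaloid E) (hx : x ∈ E) :
    DifferentiableWithinAt ℝ (outwardNormal E) E x := by
  by_contra h
  exact hE.normalDeriv_ne_zero hx (fderivWithin_zero_of_not_differentiableWithinAt h)

theorem continuousOn_outwardNormal (hE : IsOvaloid E) : ContinuousOn (outwardNormal E) E :=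
  fun _ hx => (hE.differentiableWithinAt_outwardNormal hx).continuousWithinAt

/-- The outward normal exists everywhere. Indeed the length of `outwardNormal E` is a continuous
function with values `0` and `1` on the connected set `E`, and if it were `0` throughout,
the Gaussian curvature would vanish. -/
theorem isOutwardNormal (hE : IsOvaloid E) (hx : x ∈ E) :
    IsOutwardNormal E x (outwardNormal E x) := by
  have key : ∀ y, outwardNormal E y = 0 ∨ IsOutwardNormal E y (outwardNormal E y) := by
    intro y
    by_cases h : y ∈ E ∧ ∃ ν, IsOutwardNormal E y ν
    · right
      rw [outwardNormal, dif_pos h]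
      exact h.2.choose_spec
    · left
      rw [outwardNormal, dif_neg h]
  refine (key x).resolve_left fun h0 => ?_
  have hpre : IsPreconnected ((fun y => ‖outwardNormal E y‖) '' E) :=
    hE.isConnected.isPreconnected.image _ hE.continuousOn_outwardNormal.norm
  have hzero : ∀ y ∈ E, outwardNormal E y = 0 := by
    intro y hy
    refine (key y).resolve_right fun h1 => ?_
    have h2 : (2⁻¹ : ℝ) ∈ (fun y => ‖outwardNormal E y‖) '' E := by
      refine hpre.ordConnected.out (mem_image_of_mem _ hx) (mem_image_of_mem _ hy) ?_
      simp only [h0, norm_zero, h1.1]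
      norm_num
    obtain ⟨z, -, hz⟩ := h2
    rcases key z with h3 | h3
    · simp [h3] at hz
    · have := h3.1
      simp only [this] at hz
      norm_num at hz
  refine hE.normalDeriv_ne_zero hx ?_
  rw [normalDeriv, fderivWithin_congr (f := fun _ => (0 : E3)) hzero (hzero x hx)]
  simp

theorem norm_outwardNormal (hE : IsOvaloid E) (hx : x ∈ E) : ‖outwardNormal E x‖ = 1 :=
  (hE.isOutwardNormal hx).1

theorem mem_tangentPlane_iff (hE : IsOvaloid E) (hx : x ∈ E) {v : E3} :
    v ∈ tangentPlane E x ↔ ⟪v, outwardNormal E x⟫ = 0 := by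
  have hN := hE.isOutwardNormal hx
  have h0 : outwardNormal E x ≠ 0 := by
    rw [← norm_ne_zero_iff, hN.1]; norm_num
  have h1 : tangentPlane E x ≤ (ℝ ∙ outwardNormal E x)ᗮ := fun v hv =>
    Submodule.mem_orthogonal_singleton_iff_inner_left.2 (hN.2.1 v hv)
  have : Fact (Module.finrank ℝ E3 = 2 + 1) := ⟨by simp⟩
  have h2 : tangentPlane E x = (ℝ ∙ outwardNormal E x)ᗮ := by
    refine Submodule.eq_of_le_of_finrank_eq h1 ?_
    rw [hE.finrank_tangentPlane hx, Submodule.finrank_orthogonal_span_singleton (n := 2) h0]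
  rw [h2, Submodule.mem_orthogonal_singleton_iff_inner_left]

theorem inner_fderiv_outwardNormal (hE : IsOvaloid E) (h : IsLocalParam E U φ) (hu : u ∈ U)
    (a : E2) : ⟪fderiv ℝ φ u a, outwardNormal E (φ u)⟫ = 0 :=
  (hE.mem_tangentPlane_iff (h.mapsTo hu)).1
    (h.tangentPlane_eq hu ▸ LinearMap.mem_range_self (fderiv ℝ φ u : E2 →ₗ[ℝ] E3) a)

theorem hasFDerivAt_outwardNormal_comp (hE : IsOvaloid E) (h : IsLocalParam E U φ) (hu : u ∈ U) :
    HasFDerivAt (fun v => outwardNormal E (φ v)) (normalDeriv E (φ u) ∘L fderiv ℝ φ u) u := by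
  have h1 := (hE.differentiableWithinAt_outwardNormal (h.mapsTo hu)).hasFDerivWithinAt
  have h2 := h1.comp u (h.hasFDerivAt hu).hasFDerivWithinAt h.mapsTo
  exact h2.hasFDerivAt (h.isOpen.mem_nhds hu)

theorem normalDeriv_mem_tangentPlane (hE : IsOvaloid E) (hx : x ∈ E) {v : E3}
    (hv : v ∈ tangentPlane E x) : normalDeriv E x v ∈ tangentPlane E x := by
  obtain ⟨U, φ, h, u, hu, rfl⟩ := hE.exists_localParam x hx
  rw [h.tangentPlane_eq hu] at hv
  obtain ⟨a, rfl⟩ := hv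
  rw [hE.mem_tangentPlane_iff hx]
  have h1 := (hE.hasFDerivAt_outwardNormal_comp h hu).inner ℝ
    (hE.hasFDerivAt_outwardNormal_comp h hu)
  have h2 : (fun v => ⟪outwardNormal E (φ v), outwardNormal E (φ v)⟫) =ᶠ[𝓝 u] fun _ => (1 : ℝ) := by
    filter_upwards [h.isOpen.mem_nhds hu] with v hv
    rw [real_inner_self_eq_norm_sq, hE.norm_outwardNormal (h.mapsTo hv), one_pow]
  have h3 := h1.unique ((hasFDerivAt_const (1 : ℝ) u).congr_of_eventuallyEq h2)
  have h4 := congrArg (fun l : E2 →L[ℝ] ℝ => l a) h3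
  simp only [ContinuousLinearMap.comp_apply, ContinuousLinearMap.prod_apply,
    fderivInnerCLM_apply, zero_apply] at h4
  rw [real_inner_comm (normalDeriv E (φ u) _)] at h4
  simp only [ContinuousLinearMap.coe_coe]
  linarith

/-- The Weingarten map is symmetric, by the symmetry of the second derivatives of a
parametrization. -/
theorem inner_normalDeriv_comm (hE : IsOvaloid E) (hx : x ∈ E) {v w : E3}
    (hv : v ∈ tangentPlane E x) (hw : w ∈ tangentPlane E x) :
    ⟪v, normalDeriv E x w⟫ = ⟪w, normalDeriv E x v⟫ := by
  obtain ⟨U, φ, h, u, hu, rfl⟩ := hE.exists_localParam x hx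
  rw [h.tangentPlane_eq hu] at hv hw
  obtain ⟨a, rfl⟩ := hv
  obtain ⟨b, rfl⟩ := hw
  have hd : HasFDerivAt (fderiv ℝ φ) (fderiv ℝ (fderiv ℝ φ) u) u :=
    (((h.contDiffAt hu).fderiv_right (m := 1) (by norm_num)).differentiableAt
      (by norm_num)).hasFDerivAt
  have hsymm := (h.contDiffAt hu).isSymmSndFDerivAt (by simp)
  have key : ∀ a b : E2, ⟪fderiv ℝ φ u a, normalDeriv E (φ u) (fderiv ℝ φ u b)⟫
      = - ⟪fderiv ℝ (fderiv ℝ φ) u b a, outwardNormal E (φ u)⟫ := by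
    intro a b
    have h1 := (hd.clm_apply (hasFDerivAt_const a u)).inner ℝ
      (hE.hasFDerivAt_outwardNormal_comp h hu)
    have h2 : (fun v => ⟪fderiv ℝ φ v a, outwardNormal E (φ v)⟫) =ᶠ[𝓝 u] fun _ => (0 : ℝ) := by
      filter_upwards [h.isOpen.mem_nhds hu] with v hv
      exact hE.inner_fderiv_outwardNormal h hv a
    have h3 := h1.unique ((hasFDerivAt_const (0 : ℝ) u).congr_of_eventuallyEq h2)
    have h4 := congrArg (fun l : E2 →L[ℝ] ℝ => l b) h3
    simp [fderivInnerCLM_apply] at h4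
    linarith
  simp only [ContinuousLinearMap.coe_coe]
  rw [key, key, hsymm.eq]

/-! ### Curvatures in an orthonormal frame -/

/-- Curvatures in terms of the matrix of the Weingarten map in an orthonormal frame adapted to the
surface. -/
theorem curvature_eq_of_frame (hE : IsOvaloid E) (hx : x ∈ E) (b : OrthonormalBasis (Fin 3) ℝ E3)
    (hb : b 2 = outwardNormal E x) :
    gaussianCurvature E x = ⟪b 0, normalDeriv E x (b 0)⟫ * ⟪b 1, normalDeriv E x (b 1)⟫
        - ⟪b 0, normalDeriv E x (b 1)⟫ * ⟪b 1, normalDeriv E x (b 0)⟫ ∧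
      2 * meanCurvature E x = ⟪b 0, normalDeriv E x (b 0)⟫ + ⟪b 1, normalDeriv E x (b 1)⟫ := by
  have hmem : ∀ i : Fin 2, b i.castSucc ∈ tangentPlane E x := by
    intro i
    rw [hE.mem_tangentPlane_iff hx, ← hb, b.inner_eq_ite]
    fin_cases i <;> simp
  let v : Fin 2 → tangentPlane E x := fun i => ⟨b i.castSucc, hmem i⟩
  have hv : Orthonormal ℝ v := by
    rw [orthonormal_iff_ite]
    intro i j
    simp only [v, Submodule.coe_inner, b.inner_eq_ite]
    simp
  have : Nonempty (Fin 2) := ⟨0⟩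
  have hcard : Fintype.card (Fin 2) = Module.finrank ℝ (tangentPlane E x) := by
    rw [hE.finrank_tangentPlane hx]; simp
  let bT : OrthonormalBasis (Fin 2) ℝ (tangentPlane E x) :=
    (basisOfOrthonormalOfCardEqFinrank hv hcard).toOrthonormalBasis (by simpa using hv)
  have hbT : ∀ i, bT i = v i := fun i => by simp [bT]
  have hentry : ∀ i j, LinearMap.toMatrix bT.toBasis bT.toBasis (weingarten E x) i j
      = ⟪b i.castSucc, normalDeriv E x (b j.castSucc)⟫ := by
    intro i j
    rw [LinearMap.toMatrix_apply, OrthonormalBasis.coe_toBasis_repr_apply,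
      OrthonormalBasis.repr_apply_apply, OrthonormalBasis.coe_toBasis, hbT, hbT]
    simp [weingarten, v]
  constructor
  · rw [gaussianCurvature, ← LinearMap.det_toMatrix bT.toBasis, Matrix.det_fin_two]
    simp only [hentry]
    rfl
  · rw [meanCurvature, LinearMap.trace_eq_matrix_trace ℝ bT.toBasis, Matrix.trace_fin_two]
    simp only [hentry]
    rw [mul_div_cancel₀ _ (by norm_num)]
    rfl

end IsOvaloid

/-- A unit vector is the last vector of an orthonormal basis. -/
theorem exists_orthonormalBasis_eq {ν : E3} (hν : ‖ν‖ = 1) :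
    ∃ b : OrthonormalBasis (Fin 3) ℝ E3, b 2 = ν := by
  have h1 : Orthonormal ℝ (({2} : Set (Fin 3)).domRestrict fun _ => ν) := by
    refine ⟨fun _ => hν, fun i j hij => (hij (Subsingleton.elim i j)).elim⟩
  obtain ⟨b, hb⟩ := h1.exists_orthonormalBasis_extension_of_card_eq (by simp)
  exact ⟨b, hb 2 (by simp)⟩

end

section

/-! ### Regularity of the normal field in a parametrization -/

variable {E : Set E3} {U : Set E2} {φ : E2 → E3} {u : E2} {x : E3}

/-- The linear map `(a, s) ↦ L a + s ν`. -/
noncomputable abbrev frame (L : E2 →L[ℝ] E3) (ν : E3) : E2 × ℝ →L[ℝ] E3 :=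
  L.coprod (ContinuousLinearMap.toSpanSingleton ℝ ν)

theorem exists_equiv_eq_frame {L : E2 →L[ℝ] E3} (hL : Function.Injective L) {ν : E3}
    (hν : ‖ν‖ = 1) (h : ∀ a, ⟪L a, ν⟫ = 0) :
    ∃ e : (E2 × ℝ) ≃L[ℝ] E3, (e : E2 × ℝ →L[ℝ] E3) = frame L ν := by
  have hinj : Function.Injective (frame L ν : E2 × ℝ →ₗ[ℝ] E3) := by
    rw [← LinearMap.ker_eq_bot, LinearMap.ker_eq_bot']
    rintro ⟨a, s⟩ has
    have h1 : L a + s • ν = 0 := by simpa using has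
    have h2 : ⟪L a + s • ν, ν⟫ = s := by
      rw [inner_add_left, h, real_inner_smul_left, real_inner_self_eq_norm_sq, hν]; ring
    rw [h1, inner_zero_left] at h2
    rw [← h2, zero_smul, add_zero, ← map_zero L] at h1
    rw [hL h1, ← h2]; rfl
  refine ⟨(LinearMap.linearEquivOfInjective _ hinj (by simp)).toContinuousLinearEquiv, ?_⟩
  ext x <;> rfl

theorem contDiffAt_frame {n : WithTop ℕ∞} {X : Type*} [NormedAddCommGroup X]
    [NormedSpace ℝ X] {L : X → E2 →L[ℝ] E3} {ν : X → E3} {p : X} (hL : ContDiffAt ℝ n L p)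
    (hν : ContDiffAt ℝ n ν p) : ContDiffAt ℝ n (fun q => frame (L q) (ν q)) p := by
  have h : (fun q => frame (L q) (ν q)) = fun q => (L q) ∘L ContinuousLinearMap.fst ℝ E2 ℝ +
      (ContinuousLinearMap.snd ℝ E2 ℝ).smulRight (ν q) := by
    ext q x <;> simp [frame]
  rw [h]
  have h2 : ContDiffAt ℝ n (fun q => (ContinuousLinearMap.snd ℝ E2 ℝ).smulRight (ν q)) p :=
    (ContinuousLinearMap.smulRightL ℝ (E2 × ℝ) E3
      (ContinuousLinearMap.snd ℝ E2 ℝ)).contDiff.contDiffAt.comp p hν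
  exact (hL.clm_comp contDiffAt_const).add h2

/-- In a `C²` parametrization, a differentiable unit normal field is automatically `C¹`: with
`A v = frame (Dφ v) ν₀` for the normal `ν₀` at a fixed point, the normal at a nearby point is the
normalization of the vector representing the last coordinate of `(A v)⁻¹`. -/
theorem IsOvaloid.contDiffAt_outwardNormal_comp (hE : IsOvaloid E) (h : IsLocalParam E U φ)
    (hu : u ∈ U) : ContDiffAt ℝ 1 (fun v => outwardNormal E (φ v)) u := by
  set ν₀ := outwardNormal E (φ u) with hν₀
  have hν₀1 : ‖ν₀‖ = 1 := hE.norm_outwardNormal (h.mapsTo hu)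
  obtain ⟨e, he⟩ := exists_equiv_eq_frame (h.immersion u hu) hν₀1
    (hE.inner_fderiv_outwardNormal h hu)
  have hA : ContDiffAt ℝ 1 (fun v => frame (fderiv ℝ φ v) ν₀) u :=
    contDiffAt_frame ((h.contDiffAt hu).fderiv_right (by norm_num)) contDiffAt_const
  have hinv : ContDiffAt ℝ 1 (fun v => (frame (fderiv ℝ φ v) ν₀).inverse) u := by
    have h1 : ContDiffAt ℝ 1 ContinuousLinearMap.inverse (frame (fderiv ℝ φ u) ν₀) := by
      rw [← he]; exact contDiffAt_map_inverse e
    exact h1.comp u hA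
  let l : E2 → Fin 3 → ℝ := fun v i =>
    ((frame (fderiv ℝ φ v) ν₀).inverse (EuclideanSpace.single i 1)).2
  have hl : ∀ i, ContDiffAt ℝ 1 (fun v => l v i) u := fun i =>
    (hinv.clm_apply contDiffAt_const).snd
  have hcont : ContinuousAt (fun v => outwardNormal E (φ v)) u :=
    (hE.hasFDerivAt_outwardNormal_comp h hu).continuousAt
  have hpos : ∀ᶠ v in 𝓝 u, 0 < ⟪outwardNormal E (φ v), ν₀⟫ := by
    refine (hcont.inner continuousAt_const).eventually (lt_mem_nhds ?_)
    change 0 < ⟪ν₀, ν₀⟫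
    rw [real_inner_self_eq_norm_sq, hν₀1]; norm_num
  have hev : ∀ᶠ v in 𝓝 u, ∃ e : (E2 × ℝ) ≃L[ℝ] E3,
      (e : E2 × ℝ →L[ℝ] E3) = frame (fderiv ℝ φ v) ν₀ := by
    have h1 : range ((↑) : ((E2 × ℝ) ≃L[ℝ] E3) → E2 × ℝ →L[ℝ] E3) ∈
        𝓝 (frame (fderiv ℝ φ u) ν₀) := by
      rw [← he]; exact ContinuousLinearEquiv.nhds e
    exact hA.continuousAt.eventually h1
  -- the components of the normal are proportional to `l`, with a positive factor
  have hprop : ∀ᶠ v in 𝓝 u, ∀ i, outwardNormal E (φ v) i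
      = ⟪outwardNormal E (φ v), ν₀⟫ * l v i := by
    filter_upwards [hev, h.isOpen.mem_nhds hu] with v ⟨e', he'⟩ hv i
    have h1 : outwardNormal E (φ v) i
        = ⟪outwardNormal E (φ v), EuclideanSpace.single i (1 : ℝ)⟫ := by
      rw [EuclideanSpace.inner_single_right]; simp
    have h2 : e' ((frame (fderiv ℝ φ v) ν₀).inverse (EuclideanSpace.single i 1))
        = EuclideanSpace.single i 1 := by
      rw [← he', ContinuousLinearMap.inverse_equiv]; exact e'.apply_symm_apply _
    have h3 : ∀ p, e' p = fderiv ℝ φ v p.1 + p.2 • ν₀ := fun p => by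
      have := congrArg (fun l : E2 × ℝ →L[ℝ] E3 => l p) he'
      simpa using this
    rw [h1, ← h2, h3, inner_add_right, real_inner_smul_right,
      real_inner_comm, hE.inner_fderiv_outwardNormal h hv, zero_add, mul_comm]
  have hform : ∀ᶠ v in 𝓝 u, 0 < ∑ i, l v i ^ 2 ∧ ∀ i, outwardNormal E (φ v) i
      = (√(∑ i, l v i ^ 2))⁻¹ * l v i := by
    filter_upwards [hprop, hpos, h.isOpen.mem_nhds hu] with v hv hκ hvU
    set κ := ⟪outwardNormal E (φ v), ν₀⟫
    have h1 : κ ^ 2 * ∑ i, l v i ^ 2 = 1 := by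
      have h2 := hE.norm_outwardNormal (h.mapsTo hvU)
      rw [EuclideanSpace.norm_eq, Real.sqrt_eq_one] at h2
      rw [← h2, Finset.mul_sum]
      refine Finset.sum_congr rfl fun i _ => ?_
      rw [hv i, Real.norm_eq_abs, sq_abs, mul_pow]
    have h3 : 0 < ∑ i, l v i ^ 2 := by
      by_contra! hle
      nlinarith [sq_nonneg κ]
    have h4 : κ * √(∑ i, l v i ^ 2) = 1 := by
      rw [← Real.sqrt_sq hκ.le, ← Real.sqrt_mul (sq_nonneg κ), h1, Real.sqrt_one]
    refine ⟨h3, fun i => ?_⟩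
    rw [hv i, eq_inv_of_mul_eq_one_left h4]
  rw [contDiffAt_euclidean]
  intro i
  refine ContDiffAt.congr_of_eventuallyEq ?_ (hform.mono fun v hv => hv.2 i)
  have hsum : ContDiffAt ℝ 1 (fun v => ∑ i, l v i ^ 2) u :=
    ContDiffAt.sum fun i _ => (hl i).pow 2
  have h0 := hform.self_of_nhds.1
  exact ((hsum.sqrt h0.ne').inv (Real.sqrt_pos.2 h0).ne').mul (hl i)

end

section

/-! ### Definiteness of the Weingarten map and local supporting planes -/

variable {E : Set E3} {U : Set E2} {φ : E2 → E3} {u : E2} {x : E3}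

theorem OrthonormalBasis.eq_sum_three (b : OrthonormalBasis (Fin 3) ℝ E3) (v : E3) :
    v = ⟪b 0, v⟫ • b 0 + ⟪b 1, v⟫ • b 1 + ⟪b 2, v⟫ • b 2 := by
  conv_lhs => rw [← b.sum_repr v]
  simp [Fin.sum_univ_three, b.repr_apply_apply]

namespace IsOvaloid

/-- Since its determinant is positive, the Weingarten map is positive or negative definite. -/
theorem definite (hE : IsOvaloid E) (hx : x ∈ E) :
    (∀ v ∈ tangentPlane E x, v ≠ 0 → 0 < ⟪v, normalDeriv E x v⟫) ∨
      (∀ v ∈ tangentPlane E x, v ≠ 0 → ⟪v, normalDeriv E x v⟫ < 0) := by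
  obtain ⟨b, hb⟩ := exists_orthonormalBasis_eq (hE.norm_outwardNormal hx)
  have hK := (hE.curvature_eq_of_frame hx b hb).1 ▸ hE.gaussianCurvature_pos x hx
  have h0 : b 0 ∈ tangentPlane E x := by
    rw [hE.mem_tangentPlane_iff hx, ← hb, b.inner_eq_ite]; simp
  have h1 : b 1 ∈ tangentPlane E x := by
    rw [hE.mem_tangentPlane_iff hx, ← hb, b.inner_eq_ite]; simp
  rw [hE.inner_normalDeriv_comm hx h0 h1] at hK
  have hQ : ∀ v ∈ tangentPlane E x, ⟪v, normalDeriv E x v⟫ =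
      ⟪b 0, normalDeriv E x (b 0)⟫ * ⟪b 0, v⟫ ^ 2
        + 2 * ⟪b 1, normalDeriv E x (b 0)⟫ * ⟪b 0, v⟫ * ⟪b 1, v⟫
        + ⟪b 1, normalDeriv E x (b 1)⟫ * ⟪b 1, v⟫ ^ 2 := by
    intro v hv
    have h2 : ⟪b 2, v⟫ = 0 := by
      rw [hb, real_inner_comm]; exact (hE.mem_tangentPlane_iff hx).1 hv
    have h3 : v = ⟪b 0, v⟫ • b 0 + ⟪b 1, v⟫ • b 1 := by
      conv_lhs => rw [OrthonormalBasis.eq_sum_three b v, h2, zero_smul, add_zero]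
    generalize ⟪b 0, v⟫ = α at h3 ⊢
    generalize ⟪b 1, v⟫ = β at h3 ⊢
    rw [h3]
    simp only [map_add, map_smul, inner_add_left, inner_add_right, real_inner_smul_left,
      real_inner_smul_right]
    rw [hE.inner_normalDeriv_comm hx h0 h1]
    ring
  have hne : ∀ v ∈ tangentPlane E x, v ≠ 0 → ⟪b 1, v⟫ ≠ 0 ∨ ⟪b 1, v⟫ = 0 ∧ ⟪b 0, v⟫ ≠ 0 := by
    intro v hv hv0
    by_contra! hcon
    have h4 := hcon.1
    have h5 := hcon.2 h4
    have h2 : ⟪b 2, v⟫ = 0 := by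
      rw [hb, real_inner_comm]; exact (hE.mem_tangentPlane_iff hx).1 hv
    apply hv0
    rw [OrthonormalBasis.eq_sum_three b v, h2, h4, h5]; simp
  generalize ⟪b 0, normalDeriv E x (b 0)⟫ = p at hK hQ
  generalize ⟪b 1, normalDeriv E x (b 0)⟫ = q at hK hQ
  generalize ⟪b 1, normalDeriv E x (b 1)⟫ = r at hK hQ
  have key : ∀ v ∈ tangentPlane E x, v ≠ 0 → 0 < p * ⟪v, normalDeriv E x v⟫ := by
    intro v hv hv0
    rw [hQ v hv]
    have hp : p ≠ 0 := by rintro rfl; nlinarith [sq_nonneg q]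
    have h6 : p * (p * ⟪b 0, v⟫ ^ 2 + 2 * q * ⟪b 0, v⟫ * ⟪b 1, v⟫ + r * ⟪b 1, v⟫ ^ 2)
        = (p * ⟪b 0, v⟫ + q * ⟪b 1, v⟫) ^ 2 + (p * r - q * q) * ⟪b 1, v⟫ ^ 2 := by ring
    rw [h6]
    rcases hne v hv hv0 with h7 | ⟨h7, h8⟩
    · positivity
    · rw [h7]; simp only [mul_zero, add_zero, ne_eq, OfNat.ofNat_ne_zero, not_false_eq_true,
        zero_pow]
      positivity
  rcases lt_or_ge 0 p with hp | hp
  · exact Or.inl fun v hv hv0 => pos_of_mul_pos_right (key v hv hv0) hp.le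
  · exact Or.inr fun v hv hv0 => by
      have := key v hv hv0
      by_contra! hcon
      nlinarith

theorem continuousAt_inner_fderiv (hE : IsOvaloid E) (h : IsLocalParam E U φ) (hu : u ∈ U)
    (a : E2) : ContinuousAt
      (fun v => ⟪fderiv ℝ φ v a, fderiv ℝ (fun v => outwardNormal E (φ v)) v a⟫) u := by
  have h1 : ContinuousAt (fderiv ℝ φ) u :=
    ((h.contDiffAt hu).fderiv_right (m := 1) (by norm_num)).continuousAt
  have h2 : ContinuousAt (fderiv ℝ (fun v => outwardNormal E (φ v))) u :=
    ((hE.contDiffAt_outwardNormal_comp h hu).fderiv_right (m := 0) (by norm_num)).continuousAt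
  exact (h1.clm_apply continuousAt_const).inner (h2.clm_apply continuousAt_const)

/-- Positive definiteness at one point of the surface implies positive definiteness everywhere. -/
theorem posDef_of_posDef (hE : IsOvaloid E) {y : E3} (hx : x ∈ E) (hy : y ∈ E)
    (hpos : ∀ v ∈ tangentPlane E x, v ≠ 0 → 0 < ⟪v, normalDeriv E x v⟫) :
    ∀ v ∈ tangentPlane E y, v ≠ 0 → 0 < ⟪v, normalDeriv E y v⟫ := by
  let P : E3 → Prop := fun z => ∀ v ∈ tangentPlane E z, v ≠ 0 → 0 < ⟪v, normalDeriv E z v⟫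
  refine hE.isConnected.isPreconnected.induction₂' (fun z w => P z → P w) ?_
    (fun _ _ _ _ _ _ h1 h2 h => h2 (h1 h)) hx hy hpos
  intro z hz
  obtain ⟨U, φ, h, u, hu, rfl⟩ := hE.exists_localParam z hz
  obtain ⟨a, ha⟩ := exists_ne (0 : E2)
  set f : E2 → ℝ := fun v => ⟪fderiv ℝ φ v a, fderiv ℝ (fun v => outwardNormal E (φ v)) v a⟫
  -- definiteness at `φ v` is decided by the sign of `f v`
  have hf : ∀ v ∈ U, (P (φ v) ↔ 0 < f v) ∧ f v ≠ 0 := by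
    intro v hv
    have h1 : f v = ⟪fderiv ℝ φ v a, normalDeriv E (φ v) (fderiv ℝ φ v a)⟫ := by
      simp only [f]
      rw [(hE.hasFDerivAt_outwardNormal_comp h hv).fderiv]; rfl
    have h2 : fderiv ℝ φ v a ∈ tangentPlane E (φ v) := by
      rw [h.tangentPlane_eq hv]; exact ⟨a, rfl⟩
    have h3 : fderiv ℝ φ v a ≠ 0 := fun h0 => ha (h.immersion v hv (by rw [h0, map_zero]))
    rcases hE.definite (h.mapsTo hv) with h4 | h4
    · have h5 := h4 _ h2 h3
      rw [h1]
      exact ⟨⟨fun _ => h5, fun _ => h4⟩, h5.ne'⟩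
    · have h5 := h4 _ h2 h3
      rw [h1]
      exact ⟨⟨fun hp => hp _ h2 h3, fun h6 => absurd h6 h5.not_gt⟩, h5.ne⟩
  have hev : ∀ᶠ v in 𝓝 u, 0 < f v * f u := by
    refine ((hE.continuousAt_inner_fderiv h hu a).mul continuousAt_const).eventually
      (lt_mem_nhds ?_)
    exact mul_self_pos.2 (hf u hu).2
  filter_upwards [(h.tendsto_invFunOn hu).eventually hev, h.image_invFunOn hu] with y hy1 hy2
  obtain ⟨hvU, hvy⟩ := hy2
  have h1 := hf u hu
  have h2 := hf _ hvU
  rw [hvy] at h2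
  rw [h1.1, h2.1]
  exact ⟨fun h3 => pos_of_mul_pos_left hy1 h3.le, fun h3 => pos_of_mul_pos_right hy1 h3.le⟩

/-- If the Weingarten map is definite at `x`, with sign `σ`, then near `x` the surface lies strictly
on one side of its tangent plane. Along a ray `t ↦ u + t b` in the parameter domain, the derivative
of the height `⟪φ (u + t b) - φ u, N⟫` is
`- ⟪Dφ (u + t b) b, N (φ (u + t b)) - N (φ u)⟫ = - t ⟪Dφ b, dN (Dφ b)⟫ + o(t)`. -/
theorem eventually_inner_neg (hE : IsOvaloid E) (hx : x ∈ E) {σ : ℝ}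
    (hσ : ∀ v ∈ tangentPlane E x, v ≠ 0 → 0 < σ * ⟪v, normalDeriv E x v⟫) :
    ∀ᶠ y in 𝓝[E] x, y ≠ x → σ * ⟪y - x, outwardNormal E x⟫ < 0 := by
  obtain ⟨U, φ, h, u, hu, rfl⟩ := hE.exists_localParam x hx
  set ψ : E2 → E3 := fun v => outwardNormal E (φ v) with hψ
  set L := fderiv ℝ φ u
  set M := normalDeriv E (φ u) ∘L L with hM
  have hψd : HasFDerivAt ψ M u := hE.hasFDerivAt_outwardNormal_comp h hu
  have hQ : ∀ a, a ≠ 0 → 0 < σ * ⟪L a, M a⟫ := by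
    intro a ha
    refine hσ (L a) ?_ fun h0 => ha (h.immersion u hu (by rw [map_zero]; exact h0))
    rw [h.tangentPlane_eq hu]; exact ⟨a, rfl⟩
  obtain ⟨c, hc, hcQ⟩ : ∃ c > 0, ∀ a, c * ‖a‖ ^ 2 ≤ σ * ⟪L a, M a⟫ := by
    obtain ⟨a₀, ha₀, hmin⟩ := (isCompact_sphere (0 : E2) 1).exists_isMinOn
      (NormedSpace.sphere_nonempty.2 zero_le_one)
      (f := fun a => σ * ⟪L a, M a⟫) (by fun_prop)
    refine ⟨_, hQ a₀ (by rintro rfl; simp at ha₀), fun a => ?_⟩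
    rcases eq_or_ne a 0 with rfl | ha
    · simp
    have h1 : ‖a‖⁻¹ • a ∈ Metric.sphere (0 : E2) 1 := by
      simp [norm_smul, ha]
    have h2 := hmin h1
    simp only [mem_ofPred_eq, map_smul, real_inner_smul_left, real_inner_smul_right] at h2
    have h3 : 0 < ‖a‖ := norm_pos_iff.2 ha
    calc _ ≤ _ := mul_le_mul_of_nonneg_right h2 (sq_nonneg ‖a‖)
      _ = _ := by field_simp
  obtain ⟨ε, hε, hε1, hεc⟩ : ∃ ε > 0, ε ≤ 1 ∧ |σ| * (ε * (‖L‖ + ‖M‖ + 1)) < c := by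
    refine ⟨min 1 (c / (2 * (|σ| + 1) * (‖L‖ + ‖M‖ + 1))), by positivity, min_le_left _ _, ?_⟩
    calc |σ| * (min 1 (c / (2 * (|σ| + 1) * (‖L‖ + ‖M‖ + 1))) * (‖L‖ + ‖M‖ + 1))
        ≤ (|σ| + 1) * (c / (2 * (|σ| + 1) * (‖L‖ + ‖M‖ + 1)) * (‖L‖ + ‖M‖ + 1)) := by
          gcongr
          · linarith
          · exact min_le_right _ _
      _ = c / 2 := by field_simp
      _ < c := by linarith
  have hF : ∀ᶠ b in 𝓝 (0 : E2), b ≠ 0 → u + b ∈ U ∧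
      0 < σ * ⟪fderiv ℝ φ (u + b) b, ψ (u + b) - ψ u⟫ := by
    have hL : ContinuousAt (fun b => fderiv ℝ φ (u + b)) 0 := by
      have h1 : ContinuousAt (fderiv ℝ φ) (u + 0) := by
        rw [add_zero]
        exact ((h.contDiffAt hu).fderiv_right (m := 1) (by norm_num)).continuousAt
      exact h1.comp (by fun_prop)
    have h1 : ∀ᶠ b in 𝓝 (0 : E2), ‖fderiv ℝ φ (u + b) - L‖ < ε := by
      filter_upwards [hL.eventually (Metric.ball_mem_nhds _ hε)] with b hb
      simpa [dist_eq_norm, L] using hb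
    have h2 := (hasFDerivAt_iff_isLittleO_nhds_zero.1 hψd).bound hε
    have h3 : ∀ᶠ b in 𝓝 (0 : E2), u + b ∈ U :=
      (continuous_const_add u).continuousAt.eventually_mem (by simpa using h.isOpen.mem_nhds hu)
    filter_upwards [h1, h2, h3] with b hb1 hb2 hb3 hb0
    refine ⟨hb3, ?_⟩
    have hb : 0 < ‖b‖ := norm_pos_iff.2 hb0
    have e1 : ‖fderiv ℝ φ (u + b) b - L b‖ ≤ ε * ‖b‖ :=
      ((fderiv ℝ φ (u + b) - L).le_opNorm b).trans (by gcongr)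
    have e2 : ‖ψ (u + b) - ψ u - M b‖ ≤ ε * ‖b‖ := hb2
    generalize fderiv ℝ φ (u + b) b = p at *
    generalize ψ (u + b) - ψ u = q at *
    have h4 : ⟪p, q⟫ = ⟪L b, M b⟫ + (⟪p - L b, q - M b⟫ + ⟪p - L b, M b⟫ + ⟪L b, q - M b⟫) := by
      simp only [inner_sub_left, inner_sub_right]; ring
    have h5 : |⟪p - L b, q - M b⟫ + ⟪p - L b, M b⟫ + ⟪L b, q - M b⟫|
        ≤ ε * (‖L‖ + ‖M‖ + 1) * ‖b‖ ^ 2 := by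
      have i1 := abs_real_inner_le_norm (p - L b) (q - M b)
      have i2 := abs_real_inner_le_norm (p - L b) (M b)
      have i3 := abs_real_inner_le_norm (L b) (q - M b)
      have j1 : ‖p - L b‖ * ‖q - M b‖ ≤ ε * ‖b‖ * (1 * ‖b‖) :=
        mul_le_mul e1 (e2.trans (by gcongr)) (norm_nonneg _) (by positivity)
      have j2 : ‖p - L b‖ * ‖M b‖ ≤ ε * ‖b‖ * (‖M‖ * ‖b‖) :=
        mul_le_mul e1 (M.le_opNorm b) (norm_nonneg _) (by positivity)
      have j3 : ‖L b‖ * ‖q - M b‖ ≤ ‖L‖ * ‖b‖ * (ε * ‖b‖) :=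
        mul_le_mul (L.le_opNorm b) e2 (norm_nonneg _) (by positivity)
      have i0 := abs_add_three ⟪p - L b, q - M b⟫ ⟪p - L b, M b⟫ ⟪L b, q - M b⟫
      have i4 : ε * ‖b‖ * (1 * ‖b‖) + ε * ‖b‖ * (‖M‖ * ‖b‖) + ‖L‖ * ‖b‖ * (ε * ‖b‖)
        = ε * (‖L‖ + ‖M‖ + 1) * ‖b‖ ^ 2 := by ring
      linarith
    rw [h4, mul_add]
    have h6 : |σ * (⟪p - L b, q - M b⟫ + ⟪p - L b, M b⟫ + ⟪L b, q - M b⟫)| < c * ‖b‖ ^ 2 := by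
      rw [abs_mul]
      calc _ ≤ |σ| * (ε * (‖L‖ + ‖M‖ + 1) * ‖b‖ ^ 2) := by gcongr
        _ = |σ| * (ε * (‖L‖ + ‖M‖ + 1)) * ‖b‖ ^ 2 := by ring
        _ < _ := by gcongr
    linarith [neg_abs_le (σ * (⟪p - L b, q - M b⟫ + ⟪p - L b, M b⟫ + ⟪L b, q - M b⟫)), hcQ b]
  obtain ⟨r, hr, hball⟩ := Metric.eventually_nhds_iff_ball.1 hF
  have hmain : ∀ b ∈ Metric.ball (0 : E2) r, b ≠ 0 → σ * ⟪φ (u + b) - φ u, ψ u⟫ < 0 := by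
    intro b hb hb0
    have hmem : ∀ t ∈ Icc (0 : ℝ) 1, t • b ∈ Metric.ball (0 : E2) r := by
      intro t ht
      rw [mem_ball_zero_iff, norm_smul, Real.norm_of_nonneg ht.1]
      rw [mem_ball_zero_iff] at hb
      exact (mul_le_of_le_one_left (norm_nonneg b) ht.2).trans_lt hb
    have hU : ∀ t ∈ Icc (0 : ℝ) 1, u + t • b ∈ U := by
      intro t ht
      rcases eq_or_ne t 0 with rfl | ht0
      · simpa using hu
      · exact (hball _ (hmem t ht) (smul_ne_zero ht0 hb0)).1
    have hder : ∀ t ∈ Icc (0 : ℝ) 1, HasDerivAt (fun t : ℝ => σ * ⟪φ (u + t • b) - φ u, ψ u⟫)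
        (σ * ⟪fderiv ℝ φ (u + t • b) b, ψ u⟫) t := by
      intro t ht
      have h1 : HasDerivAt (fun t : ℝ => u + t • b) b t := by
        simpa using ((hasDerivAt_id t).smul_const b).const_add u
      have h2 := ((h.hasFDerivAt (hU t ht)).comp_hasDerivAt t h1).sub_const (φ u)
      have h3 := (h2.inner ℝ (hasDerivAt_const t (ψ u))).const_mul σ
      simpa using h3
    have hanti : StrictAntiOn (fun t : ℝ => σ * ⟪φ (u + t • b) - φ u, ψ u⟫) (Icc 0 1) := by
      refine strictAntiOn_of_deriv_neg (convex_Icc 0 1)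
        (fun t ht => (hder t ht).continuousAt.continuousWithinAt) fun t ht => ?_
      rw [interior_Icc] at ht
      have ht' := Ioo_subset_Icc_self ht
      rw [(hder t ht').deriv]
      have h1 := (hball _ (hmem t ht') (smul_ne_zero ht.1.ne' hb0)).2
      rw [map_smul, real_inner_smul_left, inner_sub_right,
        hE.inner_fderiv_outwardNormal h (hU t ht'), zero_sub] at h1
      have h2 : 0 < t * -(σ * ⟪fderiv ℝ φ (u + t • b) b, ψ u⟫) := by
        calc _ < _ := h1
          _ = _ := by ring
      linarith [pos_of_mul_pos_right h2 ht.1.le]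
    have := hanti (left_mem_Icc.2 zero_le_one) (right_mem_Icc.2 zero_le_one) zero_lt_one
    simpa using this
  have hv : ∀ᶠ v in 𝓝 u, v ≠ u → σ * ⟪φ v - φ u, ψ u⟫ < 0 := by
    filter_upwards [Metric.ball_mem_nhds u hr] with v hv hne
    have := hmain (v - u) (by simpa [dist_eq_norm] using hv) (sub_ne_zero.2 hne)
    simpa using this
  filter_upwards [(h.tendsto_invFunOn hu).eventually hv, h.image_invFunOn hu] with y hy1 hy2 hne
  rw [hy2.2] at hy1
  refine hy1 fun h0 => hne ?_
  rw [← hy2.2, h0]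

end IsOvaloid

end

section

/-! ### The region bounded by an ovaloid is convex -/

variable {E : Set E3} {x p q w : E3}

theorem mem_region_of_isPreconnected {S : Set E3} (hS : IsPreconnected S) (hSE : S ⊆ Eᶜ)
    (hp : p ∈ S) (hq : q ∈ S) (h : p ∈ region E) : q ∈ region E := by
  refine ⟨hSE hq, ?_⟩
  rw [← connectedComponentIn_eq (hS.subset_connectedComponentIn hp hSE hq)]
  exact h.2

theorem notMem_region_of_ray (hw : w ≠ 0) (h : ∀ s : ℝ, 0 ≤ s → p + s • w ∉ E) :
    p ∉ region E := by
  intro hp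
  have h1 : IsPreconnected ((fun s : ℝ => p + s • w) '' Ici 0) :=
    isPreconnected_Ici.image _ (by fun_prop)
  have h2 : (fun s : ℝ => p + s • w) '' Ici 0 ⊆ connectedComponentIn Eᶜ p := by
    refine h1.subset_connectedComponentIn ⟨0, self_mem_Ici, by simp⟩ ?_
    rintro _ ⟨s, hs, rfl⟩
    exact h s hs
  obtain ⟨R, hR⟩ := (hp.2.subset h2).exists_norm_le
  have hw' : 0 < ‖w‖ := norm_pos_iff.2 hw
  have hR0 : 0 ≤ R := (norm_nonneg _).trans (hR p ⟨0, self_mem_Ici, by simp⟩)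
  have h3 := hR _ ⟨(R + ‖p‖ + 1) / ‖w‖, mem_Ici.2 (by positivity), rfl⟩
  have h4 := norm_sub_le (p + ((R + ‖p‖ + 1) / ‖w‖) • w) p
  rw [add_sub_cancel_left, norm_smul, Real.norm_of_nonneg (by positivity),
    div_mul_cancel₀ _ hw'.ne'] at h4
  simp only at h3
  linarith

theorem component_subset_region (hp : p ∈ region E) :
    connectedComponentIn Eᶜ p ⊆ region E := fun _ hq =>
  mem_region_of_isPreconnected isPreconnected_connectedComponentIn
    (connectedComponentIn_subset _ _) (mem_connectedComponentIn hp.1) hq hp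

theorem closure_component_subset (hE : IsClosed E) (p : E3) :
    closure (connectedComponentIn Eᶜ p) ⊆ connectedComponentIn Eᶜ p ∪ E := by
  intro z hz
  by_cases hzE : z ∈ E
  · exact Or.inr hzE
  · left
    obtain ⟨q, hq1, hq2⟩ := mem_closure_iff.1 hz _ hE.isOpen_compl.connectedComponentIn
      (mem_connectedComponentIn hzE)
    rw [connectedComponentIn_eq hq2, ← connectedComponentIn_eq hq1]
    exact mem_connectedComponentIn hzE

namespace IsOvaloid

/-- The normal at a point of the surface where the height in the direction `w` is maximal is `w`:
the opposite normal would make a ray in the direction `w`, which avoids the surface, start in the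
region. -/
theorem outwardNormal_eq_of_forall_inner_le (hE : IsOvaloid E) (hx : x ∈ E) (hw : ‖w‖ = 1)
    (hmax : ∀ y ∈ E, ⟪y, w⟫ ≤ ⟪x, w⟫) : outwardNormal E x = w := by
  have hperp : ∀ v ∈ tangentPlane E x, ⟪v, w⟫ = 0 := by
    obtain ⟨U, φ, h, u, hu, rfl⟩ := hE.exists_localParam x hx
    intro v hv
    rw [h.tangentPlane_eq hu] at hv
    obtain ⟨a, rfl⟩ := hv
    have h1 : IsLocalMax (fun v => ⟪φ v, w⟫) u := by
      filter_upwards [h.isOpen.mem_nhds hu] with v hv using hmax _ (h.mapsTo hv)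
    have h2 := h1.hasFDerivAt_eq_zero ((h.hasFDerivAt hu).inner ℝ (hasFDerivAt_const w u))
    have h3 := congrArg (fun l : E2 →L[ℝ] ℝ => l a) h2
    simpa [fderivInnerCLM_apply] using h3
  obtain ⟨b, hb⟩ := exists_orthonormalBasis_eq (hE.norm_outwardNormal hx)
  have hbw : ∀ i, i ≠ 2 → ⟪b i, w⟫ = 0 := fun i hi => hperp _ <| by
    rw [hE.mem_tangentPlane_iff hx, ← hb, b.inner_eq_ite, if_neg hi]
  have h1 : w = ⟪b 2, w⟫ • outwardNormal E x := by
    conv_lhs => rw [OrthonormalBasis.eq_sum_three b w]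
    rw [hbw 0 (by decide), hbw 1 (by decide), ← hb]; simp
  have h2 : |⟪b 2, w⟫| = 1 := by
    have := congrArg norm h1
    rw [norm_smul, hw, hE.norm_outwardNormal hx, mul_one] at this
    exact this.symm
  rcases eq_or_eq_neg_of_abs_eq h2 with h3 | h3
  · rw [h1, h3, one_smul]
  · exfalso
    rw [h3, neg_one_smul] at h1
    obtain ⟨t, ht, ht0⟩ := ((hE.isOutwardNormal hx).2.2.and self_mem_nhdsWithin).exists
    refine notMem_region_of_ray (w := w) (by rw [← norm_ne_zero_iff, hw]; norm_num)
      (fun s hs hmem => ?_) ht.1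
    have h4 := hmax _ hmem
    have h5 : x - t • outwardNormal E x + s • w = x + (t + s) • w := by rw [h1]; module
    rw [h5, inner_add_left, real_inner_smul_left, real_inner_self_eq_norm_sq, hw] at h4
    have : 0 < t := ht0
    linarith

theorem exists_outwardNormal_eq (hE : IsOvaloid E) (hw : ‖w‖ = 1) :
    ∃ x ∈ E, outwardNormal E x = w ∧ ∀ y ∈ E, ⟪y, w⟫ ≤ ⟪x, w⟫ := by
  obtain ⟨x, hx, hmax⟩ := hE.isCompact.exists_isMaxOn hE.isConnected.nonempty
    (f := fun y => ⟪y, w⟫) (by fun_prop)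
  exact ⟨x, hx, hE.outwardNormal_eq_of_forall_inner_le hx hw hmax, hmax⟩

theorem inner_normalDeriv_pos (hE : IsOvaloid E) (hx : x ∈ E) {v : E3}
    (hv : v ∈ tangentPlane E x) (hv0 : v ≠ 0) : 0 < ⟪v, normalDeriv E x v⟫ := by
  obtain ⟨y, hy, hyw, hmax⟩ := hE.exists_outwardNormal_eq
    (w := EuclideanSpace.single 0 (1 : ℝ)) (by simp)
  refine hE.posDef_of_posDef hy hx ?_ v hv hv0
  refine (hE.definite hy).resolve_right fun hneg => ?_
  have h1 := hE.eventually_inner_neg hy (σ := -1) fun v hv hv0 => by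
    have := hneg v hv hv0; linarith
  obtain ⟨U, φ, h, u, hu, rfl⟩ := hE.exists_localParam y hy
  have h2 : Tendsto φ (𝓝[≠] u) (𝓝[E] (φ u)) := by
    refine tendsto_nhdsWithin_iff.2
      ⟨(h.hasFDerivAt hu).continuousAt.tendsto.mono_left nhdsWithin_le_nhds, ?_⟩
    filter_upwards [nhdsWithin_le_nhds (h.isOpen.mem_nhds hu)] with v hv using h.mapsTo hv
  obtain ⟨v, ⟨hv1, hvU⟩, hvu⟩ := (((h2.eventually h1).and
    (nhdsWithin_le_nhds (h.isOpen.mem_nhds hu))).and self_mem_nhdsWithin).exists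
  have h3 := hv1 fun h0 => hvu (h.injOn hvU hu h0)
  have h4 := hmax _ (h.mapsTo hvU)
  rw [hyw, inner_sub_left] at h3
  linarith

/-- Near `x ∈ E`, the closed half space bounded by the tangent plane and lying on the side of the
outward normal contains no point of the surface or of the region, apart from `x`. -/
theorem eventually_notMem (hE : IsOvaloid E) (hx : x ∈ E) :
    ∀ᶠ y in 𝓝 x, y ≠ x → 0 ≤ ⟪y - x, outwardNormal E x⟫ → y ∉ E ∧ y ∉ region E := by
  have h1 := hE.eventually_inner_neg hx (σ := 1) fun v hv hv0 => by
    simpa using hE.inner_normalDeriv_pos hx hv hv0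
  rw [eventually_nhdsWithin_iff] at h1
  obtain ⟨r, hr, hball⟩ := Metric.eventually_nhds_iff_ball.1 h1
  set N := outwardNormal E x with hN
  have hN1 : ‖N‖ = 1 := hE.norm_outwardNormal hx
  obtain ⟨t, ⟨htreg, htr⟩, ht0⟩ := (((hE.isOutwardNormal hx).2.2.and
    (nhdsWithin_le_nhds (gt_mem_nhds hr))).and self_mem_nhdsWithin).exists
  have ht0 : 0 < t := ht0
  filter_upwards [Metric.ball_mem_nhds x hr] with y hy hyx hy0
  have hyE : y ∉ E := fun h => by
    have := hball y hy h hyx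
    rw [one_mul] at this
    linarith
  refine ⟨hyE, fun hreg => htreg.2 ?_⟩
  have htball : x + t • N ∈ Metric.ball x r := by
    simpa [norm_smul, hN1, abs_of_pos ht0] using htr
  refine mem_region_of_isPreconnected (convex_segment y (x + t • N)).isPreconnected ?_
    (left_mem_segment ℝ _ _) (right_mem_segment ℝ _ _) hreg
  intro z hz hzE
  have hzb := (convex_ball x r).segment_subset hy htball hz
  obtain ⟨α, β, hα, hβ, hαβ, rfl⟩ := hz
  have e1 : α • y + β • (x + t • N) - x = α • (y - x) + (β * t) • N := by
    rw [eq_sub_of_add_eq hαβ]; module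
  have e2 : ⟪α • y + β • (x + t • N) - x, N⟫ = α * ⟪y - x, N⟫ + β * t := by
    rw [e1, inner_add_left, real_inner_smul_left, real_inner_smul_left,
      real_inner_self_eq_norm_sq, hN1]; ring
  rcases eq_or_lt_of_le hβ with h0 | h0
  · rw [← h0, add_zero] at hαβ
    rw [hαβ, ← h0, one_smul, zero_smul, add_zero] at hzE
    exact hyE hzE
  · have h3 : 0 < ⟪α • y + β • (x + t • N) - x, N⟫ := by rw [e2]; positivity
    have h4 := hball _ hzb hzE fun heq => by
      rw [heq, sub_self, inner_zero_left] at h3; exact h3.false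
    linarith

/-- The components of the region are convex. Fix `p`; the set of points `q` of the component for
which the segment from `p` to `q` stays in the component is open, and it is closed since a limit
segment cannot touch the surface: near a point of contact it would have to lie strictly below the
tangent plane. -/
theorem convex_component (hE : IsOvaloid E) (hp : p ∈ region E) :
    Convex ℝ (connectedComponentIn Eᶜ p) := by
  set Ω := connectedComponentIn Eᶜ p with hΩ
  have hcl : IsClosed E := hE.isCompact.isClosed
  have hopen : IsOpen Ω := hcl.isOpen_compl.connectedComponentIn
  have hreg : Ω ⊆ region E := component_subset_region hp
  rw [convex_iff_segment_subset]
  intro a ha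
  suffices h : Ω ⊆ {q | segment ℝ a q ⊆ Ω} from fun q hq => h hq
  refine isPreconnected_connectedComponentIn.subset_of_closure_inter_subset ?_ ?_ ?_
  · have hc : Continuous fun z : E3 × ℝ => AffineMap.lineMap a z.1 z.2 := by
      simp only [AffineMap.lineMap_apply_module]; fun_prop
    have : {q | segment ℝ a q ⊆ Ω} = {q | ∀ t ∈ Icc (0 : ℝ) 1, AffineMap.lineMap a q t ∈ Ω} := by
      ext q
      rw [mem_ofPred_eq, segment_eq_image_lineMap, image_subset_iff]; rfl
    rw [this, isOpen_iff_eventually]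
    intro q hq
    exact isCompact_Icc.eventually_forall_of_forall_eventually
      fun t ht => (hopen.preimage hc).mem_nhds (hq t ht)
  · exact ⟨a, ha, by simpa using ha⟩
  · rintro q ⟨hq, hqΩ⟩
    have hsub : segment ℝ a q ⊆ closure Ω := by
      rw [segment_eq_image_lineMap]
      rintro _ ⟨t, ht, rfl⟩
      have hc : Continuous fun z : E3 => AffineMap.lineMap a z t := by
        simp only [AffineMap.lineMap_apply_module]; fun_prop
      refine map_mem_closure (f := fun z => AffineMap.lineMap a z t) hc hq fun z hz => ?_
      refine hz ?_
      rw [segment_eq_image_lineMap]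
      exact ⟨t, ht, rfl⟩
    have hsub' : segment ℝ a q ⊆ Ω ∪ E := hsub.trans (closure_component_subset hcl p)
    intro z hz
    refine (hsub' hz).resolve_right fun hzE => ?_
    have hev := hE.eventually_notMem hzE
    have haq : a ≠ q := by
      rintro rfl
      rw [segment_same, mem_singleton_iff] at hz
      exact (hreg ha).1 (hz ▸ hzE)
    rw [segment_eq_image_lineMap] at hz
    obtain ⟨t, ht, rfl⟩ := hz
    have ht0 : 0 < t := ht.1.lt_of_ne fun h => by
      rw [← h, AffineMap.lineMap_apply_zero] at hzE; exact (hreg ha).1 hzE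
    have ht1 : t < 1 := ht.2.lt_of_ne fun h => by
      rw [h, AffineMap.lineMap_apply_one] at hzE; exact (hreg hqΩ).1 hzE
    set N := outwardNormal E (AffineMap.lineMap a q t)
    -- move along the segment in the direction in which the height does not decrease
    obtain ⟨σ, hσ0, hσ⟩ : ∃ σ : ℝ, σ ≠ 0 ∧ 0 ≤ σ * ⟪q - a, N⟫ := by
      rcases le_total 0 ⟪q - a, N⟫ with h | h
      · exact ⟨1, one_ne_zero, by simpa using h⟩
      · exact ⟨-1, by norm_num, by simpa using h⟩
    have hc : ContinuousAt (fun s : ℝ => (AffineMap.lineMap a q (t + s * σ) : E3)) 0 := by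
      simp only [AffineMap.lineMap_apply_module]; fun_prop
    have hc2 : ContinuousAt (fun s : ℝ => t + s * σ) 0 := by fun_prop
    have hev2 := hc.tendsto.eventually (p := fun y => y ≠ AffineMap.lineMap a q t →
      0 ≤ ⟪y - AffineMap.lineMap a q t, N⟫ → y ∉ E ∧ y ∉ region E) (by simpa using hev)
    have hev3 := hc2.eventually (Icc_mem_nhds (a := 0) (b := 1) (by simpa using ht0)
      (by simpa using ht1))
    obtain ⟨s, ⟨hs1, hs2⟩, hs0⟩ := (((hev2.filter_mono nhdsWithin_le_nhds).and
      (hev3.filter_mono nhdsWithin_le_nhds)).and (self_mem_nhdsWithin (s := Ioi (0 : ℝ)))).exists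
    have hs0 : 0 < s := hs0
    have e1 : AffineMap.lineMap a q (t + s * σ) - AffineMap.lineMap a q t
        = (s * σ) • (q - a) := by
      simp only [AffineMap.lineMap_apply_module]; module
    have h1 := hs1 (fun h => by
      rw [← sub_eq_zero, e1, smul_eq_zero] at h
      rcases h with h | h
      · exact mul_ne_zero hs0.ne' hσ0 h
      · exact haq (sub_eq_zero.1 h).symm) (by
      rw [e1, real_inner_smul_left, mul_assoc]; positivity)
    have h2 : AffineMap.lineMap a q (t + s * σ) ∈ Ω ∪ E := hsub' (by
      rw [segment_eq_image_lineMap]; exact ⟨_, hs2, rfl⟩)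
    exact h2.elim (fun h => h1.2 (hreg h)) h1.1

/-- Near a point of the surface, short inner normals of uniform length sweep out a connected set
that does not meet the surface. -/
theorem exists_isPreconnected_normals (hE : IsOvaloid E) (hx : x ∈ E) :
    ∃ W ∈ 𝓝[E] x, ∃ t₀ : ℝ, 0 < t₀ ∧ ∃ S : Set E3, IsPreconnected S ∧ S ⊆ Eᶜ ∧
      ∀ y ∈ W, ∀ t ∈ Ioo 0 t₀, y - t • outwardNormal E y ∈ S := by
  obtain ⟨U, φ, h, u, hu, rfl⟩ := hE.exists_localParam x hx
  have h1 := h.abs_inner_sub_le hu (hE.inner_fderiv_outwardNormal h hu) (ε := 1 / 2) (by norm_num)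
  obtain ⟨r, hr, hchord⟩ : ∃ r > 0, ∀ y ∈ E, ∀ z ∈ E, dist y (φ u) < r → dist z (φ u) < r →
      |⟪y - z, outwardNormal E (φ u)⟫| ≤ 1 / 2 * ‖y - z‖ := by
    obtain ⟨T, hT, hTT⟩ := eventually_prod_self_iff (r := fun y z =>
      |⟪y - z, outwardNormal E (φ u)⟫| ≤ 1 / 2 * ‖y - z‖) |>.1 h1
    obtain ⟨r, hr, hrT⟩ := Metric.mem_nhdsWithin_iff.1 hT
    exact ⟨r, hr, fun y hy z hz hyr hzr => hTT y (hrT ⟨hyr, hy⟩) z (hrT ⟨hzr, hz⟩)⟩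
  have hψ : ContinuousAt (fun v => outwardNormal E (φ v)) u :=
    (hE.hasFDerivAt_outwardNormal_comp h hu).continuousAt
  have e1 : ∀ᶠ v in 𝓝 u, 1 / 2 < ⟪outwardNormal E (φ v), outwardNormal E (φ u)⟫ := by
    refine (hψ.inner continuousAt_const).eventually (lt_mem_nhds ?_)
    change 1 / 2 < ⟪outwardNormal E (φ u), outwardNormal E (φ u)⟫
    rw [real_inner_self_eq_norm_sq, hE.norm_outwardNormal hx]; norm_num
  have e2 : ∀ᶠ v in 𝓝 u, dist (φ v) (φ u) < r / 2 :=
    (h.hasFDerivAt hu).continuousAt.eventually (Metric.ball_mem_nhds _ (by positivity))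
  obtain ⟨δ, hδ, hball⟩ := Metric.eventually_nhds_iff_ball.1
    ((e1.and e2).and (h.isOpen.mem_nhds hu))
  refine ⟨φ '' (Metric.ball u δ ∩ U), h.image_mem_nhdsWithin hu (Metric.ball_mem_nhds u hδ),
    r / 2, by positivity,
    (fun z : E2 × ℝ => φ z.1 - z.2 • outwardNormal E (φ z.1)) '' (Metric.ball u δ ×ˢ Ioo 0 (r / 2)),
    ?_, ?_, ?_⟩
  · refine ((convex_ball u δ).prod (convex_Ioo 0 (r / 2))).isPreconnected.image _ ?_
    rintro ⟨v, t⟩ ⟨hv, -⟩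
    have hvU := (hball v hv).2
    have c1 : ContinuousAt (fun z : E2 × ℝ => φ z.1) (v, t) :=
      ContinuousAt.comp (f := Prod.fst) (h.hasFDerivAt hvU).continuousAt continuousAt_fst
    have c2 : ContinuousAt (fun z : E2 × ℝ => outwardNormal E (φ z.1)) (v, t) :=
      ContinuousAt.comp (f := Prod.fst) (g := fun v => outwardNormal E (φ v))
        (hE.hasFDerivAt_outwardNormal_comp h hvU).continuousAt continuousAt_fst
    exact (c1.sub (continuousAt_snd.smul c2)).continuousWithinAt
  · rintro _ ⟨⟨v, t⟩, ⟨hv, ht⟩, rfl⟩ hmem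
    obtain ⟨⟨hv1, hv2⟩, hvU⟩ := hball v hv
    simp only at hv ht hmem
    have hvE := h.mapsTo hvU
    have n1 : ‖t • outwardNormal E (φ v)‖ = t := by
      rw [norm_smul, hE.norm_outwardNormal hvE, mul_one, Real.norm_of_nonneg ht.1.le]
    have h3 := hchord _ hvE _ hmem (by linarith) (by
      have := dist_triangle (φ v - t • outwardNormal E (φ v)) (φ v) (φ u)
      rw [dist_eq_norm (φ v - _) (φ v), sub_sub_cancel_left, norm_neg, n1] at this
      linarith [ht.2])
    rw [sub_sub_cancel, n1, real_inner_smul_left] at h3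
    have h4 := (le_abs_self _).trans h3
    nlinarith [ht.1]
  · rintro _ ⟨v, ⟨hv, -⟩, rfl⟩ t ht
    exact ⟨(v, t), ⟨hv, ht⟩, rfl⟩

/-- Some component of the region is adjacent to all points of the surface: which component is met
by the inner normal at `x` depends locally constantly on `x`, and `E` is connected. -/
theorem exists_subset_closure_component (hE : IsOvaloid E) :
    ∃ p ∈ region E, E ⊆ closure (connectedComponentIn Eᶜ p) := by
  obtain ⟨x₀, hx₀⟩ := hE.isConnected.nonempty
  obtain ⟨t₁, ht₁⟩ := (hE.isOutwardNormal hx₀).2.2.exists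
  let Adj : E3 → E3 → Prop := fun p x =>
    ∀ᶠ t : ℝ in 𝓝[>] 0, x - t • outwardNormal E x ∈ connectedComponentIn Eᶜ p
  have hloc : ∀ x ∈ E, ∀ᶠ y in 𝓝[E] x, ∀ p, Adj p x ↔ Adj p y := by
    intro x hx
    obtain ⟨W, hW, t₀, ht₀, S, hS, hSE, hmem⟩ := hE.exists_isPreconnected_normals hx
    have hxW : x ∈ W := mem_of_mem_nhdsWithin hx hW
    have key : ∀ y ∈ W, ∀ z ∈ W, ∀ p, Adj p y → Adj p z := by
      intro y hy z hz p hyp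
      have h0 : ∀ᶠ t : ℝ in 𝓝[>] 0, t ∈ Ioo 0 t₀ := Ioo_mem_nhdsGT ht₀
      obtain ⟨t, ht1, ht2⟩ := (hyp.and h0).exists
      filter_upwards [h0] with s hs
      rw [connectedComponentIn_eq ht1]
      exact hS.subset_connectedComponentIn (hmem y hy t ht2) hSE (hmem z hz s hs)
    filter_upwards [hW] with y hy p
    exact ⟨key x hxW y hy p, key y hy x hxW p⟩
  obtain ⟨W, hW, t₀, ht₀, S, hS, hSE, hmem⟩ := hE.exists_isPreconnected_normals hx₀
  have h0 : ∀ᶠ t : ℝ in 𝓝[>] 0, t ∈ Ioo 0 t₀ := Ioo_mem_nhdsGT ht₀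
  obtain ⟨t, ht, ht2⟩ := ((hE.isOutwardNormal hx₀).2.2.and h0).exists
  have hxW : x₀ ∈ W := mem_of_mem_nhdsWithin hx₀ hW
  have hadj₀ : Adj (x₀ - t • outwardNormal E x₀) x₀ := by
    filter_upwards [h0] with s hs
    exact hS.subset_connectedComponentIn (hmem _ hxW t ht2) hSE (hmem _ hxW s hs)
  refine ⟨_, ht.1, fun y hy => ?_⟩
  have hadj : Adj (x₀ - t • outwardNormal E x₀) y :=
    hE.isConnected.isPreconnected.induction₂' (fun a b => ∀ p, Adj p a ↔ Adj p b)
      (fun a ha => (hloc a ha).mono fun b hb => ⟨hb, fun p => (hb p).symm⟩)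
      (fun _ _ _ _ _ _ h1 h2 p => (h1 p).trans (h2 p)) hx₀ hy _ |>.1 hadj₀
  refine mem_closure_of_tendsto (f := fun t : ℝ => y - t • outwardNormal E y)
    (b := 𝓝[>] (0 : ℝ)) ?_ hadj
  have : ContinuousAt (fun t : ℝ => y - t • outwardNormal E y) 0 := by fun_prop
  simpa using this.tendsto.mono_left nhdsWithin_le_nhds

/-- An ovaloid lies strictly on one side of each of its tangent planes. -/
theorem inner_sub_neg (hE : IsOvaloid E) {y : E3} (hx : x ∈ E) (hy : y ∈ E) (hne : y ≠ x) :
    ⟪y - x, outwardNormal E x⟫ < 0 := by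
  obtain ⟨p, hp, hsub⟩ := hE.exists_subset_closure_component
  have hconv := (hE.convex_component hp).closure
  by_contra! hcon
  have hc : ContinuousAt (fun s : ℝ => x + s • (y - x)) 0 := by fun_prop
  have h1 := hc.tendsto.eventually (p := fun z => z ≠ x → 0 ≤ ⟪z - x, outwardNormal E x⟫ →
    z ∉ E ∧ z ∉ region E) (by simpa using hE.eventually_notMem hx)
  obtain ⟨s, hs1, hs⟩ := ((h1.filter_mono nhdsWithin_le_nhds).and
    (Ioo_mem_nhdsGT one_pos)).exists
  have h2 := hs1 (by simp [hs.1.ne', sub_ne_zero.2 hne]) (by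
    rw [add_sub_cancel_left, real_inner_smul_left]
    exact mul_nonneg hs.1.le hcon)
  have h3 := hconv.add_smul_sub_mem (hsub hx) (hsub hy) (Ioo_subset_Icc_self hs)
  exact (closure_component_subset hE.isCompact.isClosed p h3).elim
    (fun h => h2.2 (component_subset_region hp h)) h2.1

theorem injOn_outwardNormal (hE : IsOvaloid E) : InjOn (outwardNormal E) E := by
  intro x hx y hy hxy
  by_contra hne
  have h1 := hE.inner_sub_neg hx hy (Ne.symm hne)
  have h2 := hE.inner_sub_neg hy hx hne
  rw [hxy] at h1
  rw [inner_sub_left] at h1 h2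
  linarith

end IsOvaloid

end

section

/-! ### The inverse of the Gauss map -/

variable {E : Set E3} {U : Set E2} {φ : E2 → E3} {u : E2} {x w y : E3}

/-- The inverse of the Gauss map; only the values on the unit sphere are meaningful. -/
noncomputable def gaussInv (E : Set E3) (w : E3) : E3 :=
  Function.invFunOn (outwardNormal E) E w

/-- The inverse of the Gauss map, extended to a map that is constant on open rays from the origin;
away from the origin it is the gradient of the support function. -/
noncomputable def gaussInvExt (E : Set E3) (y : E3) : E3 :=
  gaussInv E (‖y‖⁻¹ • y)

theorem gaussInvExt_smul {r : ℝ} (hr : 0 < r) (y : E3) :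
    gaussInvExt E (r • y) = gaussInvExt E y := by
  rw [gaussInvExt, gaussInvExt, norm_smul, Real.norm_of_nonneg hr.le, smul_smul, mul_inv,
    mul_right_comm, inv_mul_cancel₀ hr.ne', one_mul]

theorem gaussInvExt_of_norm_eq_one (hw : ‖w‖ = 1) : gaussInvExt E w = gaussInv E w := by
  rw [gaussInvExt, hw, inv_one, one_smul]

theorem norm_inv_norm_smul (hy : y ≠ 0) : ‖‖y‖⁻¹ • y‖ = 1 := by
  rw [norm_smul, norm_inv, norm_norm, inv_mul_cancel₀ (norm_ne_zero_iff.2 hy)]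

namespace IsOvaloid

theorem gaussInv_spec (hE : IsOvaloid E) (hw : ‖w‖ = 1) :
    gaussInv E w ∈ E ∧ outwardNormal E (gaussInv E w) = w := by
  obtain ⟨x, hx, hxw, -⟩ := hE.exists_outwardNormal_eq hw
  exact Function.invFunOn_pos ⟨x, hx, hxw⟩

theorem gaussInv_outwardNormal (hE : IsOvaloid E) (hx : x ∈ E) :
    gaussInv E (outwardNormal E x) = x :=
  hE.injOn_outwardNormal.leftInvOn_invFunOn hx

theorem inner_le_inner_gaussInv (hE : IsOvaloid E) (hw : ‖w‖ = 1) (hy : y ∈ E) :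
    ⟪y, w⟫ ≤ ⟪gaussInv E w, w⟫ := by
  obtain ⟨hX, hN⟩ := hE.gaussInv_spec hw
  rcases eq_or_ne y (gaussInv E w) with h | h
  · rw [h]
  · have := hE.inner_sub_neg hX hy h
    rw [hN, inner_sub_left] at this
    linarith

theorem support_eq (hE : IsOvaloid E) (hw : ‖w‖ = 1) :
    support E 0 w = ⟪gaussInv E w, w⟫ := by
  have : IsGreatest ((fun x => ⟪x - 0, w⟫) '' E) ⟪gaussInv E w, w⟫ := by
    refine ⟨⟨gaussInv E w, (hE.gaussInv_spec hw).1, by simp⟩, ?_⟩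
    rintro _ ⟨y, hy, rfl⟩
    simpa using hE.inner_le_inner_gaussInv hw hy
  exact this.csSup_eq

theorem continuousOn_gaussInv (hE : IsOvaloid E) :
    ContinuousOn (gaussInv E) (Metric.sphere 0 1) := by
  rw [continuousOn_iff_isClosed]
  intro F hF
  refine ⟨outwardNormal E '' (E ∩ F), ?_, ?_⟩
  · exact ((hE.isCompact.inter_right hF).image_of_continuousOn
      (hE.continuousOn_outwardNormal.mono inter_subset_left)).isClosed
  · ext w
    constructor
    · rintro ⟨hw, hw1⟩
      obtain ⟨hX, hN⟩ := hE.gaussInv_spec (mem_sphere_zero_iff_norm.1 hw1)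
      exact ⟨⟨_, ⟨hX, hw⟩, hN⟩, hw1⟩
    · rintro ⟨⟨x, ⟨hxE, hxF⟩, rfl⟩, hw1⟩
      refine ⟨?_, hw1⟩
      rw [mem_preimage, hE.gaussInv_outwardNormal hxE]
      exact hxF

theorem continuousAt_gaussInvExt (hE : IsOvaloid E) (hy : y ≠ 0) :
    ContinuousAt (gaussInvExt E) y := by
  have h1 : ContinuousAt (fun y : E3 => ‖y‖⁻¹ • y) y :=
    (continuousAt_id.norm.inv₀ (norm_ne_zero_iff.2 hy)).smul continuousAt_id
  have h2 : Tendsto (fun y : E3 => ‖y‖⁻¹ • y) (𝓝 y) (𝓝[Metric.sphere 0 1] (‖y‖⁻¹ • y)) := by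
    refine tendsto_nhdsWithin_iff.2 ⟨h1, ?_⟩
    filter_upwards [isOpen_ne.mem_nhds hy] with z hz
    exact mem_sphere_zero_iff_norm.2 (norm_inv_norm_smul hz)
  exact (hE.continuousOn_gaussInv _
    (mem_sphere_zero_iff_norm.2 (norm_inv_norm_smul hy))).tendsto.comp h2

/-! ### The cone over a parametrization of the sphere by the Gauss map -/

/-- In a parametrization, the Gauss map is an immersion, because the Weingarten map is definite. -/
theorem injective_normalDeriv_comp (hE : IsOvaloid E) (h : IsLocalParam E U φ) (hu : u ∈ U) :
    Function.Injective (normalDeriv E (φ u) ∘L fderiv ℝ φ u) := by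
  rw [injective_iff_map_eq_zero]
  intro a ha
  by_contra ha0
  have h1 : fderiv ℝ φ u a ∈ tangentPlane E (φ u) := by
    rw [h.tangentPlane_eq hu]; exact ⟨a, rfl⟩
  have h2 := hE.inner_normalDeriv_pos (h.mapsTo hu) h1
    fun h0 => ha0 (h.immersion u hu (by rw [h0, map_zero]))
  rw [ContinuousLinearMap.comp_apply] at ha
  rw [ha, inner_zero_right] at h2
  exact h2.false

theorem inner_normalDeriv_comp (hE : IsOvaloid E) (h : IsLocalParam E U φ) (hu : u ∈ U) (a : E2) :
    ⟪(normalDeriv E (φ u) ∘L fderiv ℝ φ u) a, outwardNormal E (φ u)⟫ = 0 := by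
  refine (hE.mem_tangentPlane_iff (h.mapsTo hu)).1
    (hE.normalDeriv_mem_tangentPlane (h.mapsTo hu) ?_)
  rw [h.tangentPlane_eq hu]; exact ⟨a, rfl⟩

theorem hasFDerivAt_cone (hE : IsOvaloid E) (h : IsLocalParam E U φ) (hu : u ∈ U) (r : ℝ) :
    HasFDerivAt (fun z : E2 × ℝ => z.2 • outwardNormal E (φ z.1))
      (frame (r • (normalDeriv E (φ u) ∘L fderiv ℝ φ u)) (outwardNormal E (φ u))) (u, r) := by
  have h1 : HasFDerivAt (fun z : E2 × ℝ => outwardNormal E (φ z.1)) _ (u, r) :=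
    HasFDerivAt.comp (g := fun v => outwardNormal E (φ v)) (u, r)
      (hE.hasFDerivAt_outwardNormal_comp h hu) hasFDerivAt_fst
  refine (hasFDerivAt_snd.smul h1).congr_fderiv ?_
  ext z <;> simp [frame]

theorem contDiffAt_cone (hE : IsOvaloid E) (h : IsLocalParam E U φ) (hu : u ∈ U) (r : ℝ) :
    ContDiffAt ℝ 1 (fun z : E2 × ℝ => z.2 • outwardNormal E (φ z.1)) (u, r) := by
  have h1 : ContDiffAt ℝ 1 (fun z : E2 × ℝ => outwardNormal E (φ z.1)) (u, r) :=
    ContDiffAt.comp (g := fun v => outwardNormal E (φ v)) (u, r)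
      (hE.contDiffAt_outwardNormal_comp h hu) contDiffAt_fst
  exact contDiffAt_snd.smul h1

theorem gaussInvExt_cone (hE : IsOvaloid E) (h : IsLocalParam E U φ) (hu : u ∈ U) {r : ℝ}
    (hr : 0 < r) : gaussInvExt E (r • outwardNormal E (φ u)) = φ u := by
  rw [gaussInvExt_smul hr, gaussInvExt_of_norm_eq_one (hE.norm_outwardNormal (h.mapsTo hu)),
    hE.gaussInv_outwardNormal (h.mapsTo hu)]

/-- The extended inverse Gauss map is `C¹`, by the inverse function theorem for the cone over a
parametrization of the sphere by `N ∘ φ`. -/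
theorem contDiffAt_gaussInvExt (hE : IsOvaloid E) (hy : y ≠ 0) :
    ContDiffAt ℝ 1 (gaussInvExt E) y := by
  have hspec : ∀ z : E3, z ≠ 0 → gaussInvExt E z ∈ E ∧
      ‖z‖ • outwardNormal E (gaussInvExt E z) = z := fun z hz => by
    obtain ⟨h1, h2⟩ := hE.gaussInv_spec (norm_inv_norm_smul hz)
    refine ⟨h1, ?_⟩
    rw [gaussInvExt, h2, smul_smul, mul_inv_cancel₀ (norm_ne_zero_iff.2 hz), one_smul]
  obtain ⟨U, φ, h, u, hu, hux⟩ := hE.exists_localParam _ (hspec y hy).1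
  have hr : 0 < ‖y‖ := norm_pos_iff.2 hy
  obtain ⟨e, he⟩ := exists_equiv_eq_frame
    (L := ‖y‖ • (normalDeriv E (φ u) ∘L fderiv ℝ φ u)) (ν := outwardNormal E (φ u))
    (by
      intro a b hab
      exact hE.injective_normalDeriv_comp h hu (smul_right_injective E3 hr.ne' hab))
    (hE.norm_outwardNormal (h.mapsTo hu))
    (fun a => by
      have := hE.inner_normalDeriv_comp h hu a
      rw [smul_apply, real_inner_smul_left, this, mul_zero])
  have hC := hE.contDiffAt_cone h hu ‖y‖
  have hC' : HasFDerivAt (fun z : E2 × ℝ => z.2 • outwardNormal E (φ z.1))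
      (e : E2 × ℝ →L[ℝ] E3) (u, ‖y‖) := he ▸ hE.hasFDerivAt_cone h hu ‖y‖
  have hCu : ‖y‖ • outwardNormal E (φ u) = y := by rw [hux]; exact (hspec y hy).2
  have hloc := hC.to_localInverse hC' one_ne_zero
  simp only [hCu] at hloc
  have hT : Tendsto (gaussInvExt E) (𝓝 y) (𝓝[E] (φ u)) := by
    refine tendsto_nhdsWithin_iff.2 ⟨hux ▸ hE.continuousAt_gaussInvExt hy, ?_⟩
    filter_upwards [isOpen_ne.mem_nhds hy] with z hz using (hspec z hz).1
  have hg : Tendsto (fun z => (Function.invFunOn φ U (gaussInvExt E z), ‖z‖)) (𝓝 y)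
      (𝓝 (u, ‖y‖)) := by
    rw [nhds_prod_eq]
    exact ((h.tendsto_invFunOn hu).comp hT).prodMk continuous_norm.continuousAt
  have hleft := (hC.hasStrictFDerivAt' hC' one_ne_zero).eventually_left_inverse
  refine (ContDiffAt.comp y (g := φ) ?_ hloc.fst).congr_of_eventuallyEq ?_
  · have : (hC.localInverse hC' one_ne_zero y).1 = u := by
      have := hleft.self_of_nhds
      simp only [hCu] at this
      exact congrArg Prod.fst this
    rw [this]
    exact (h.contDiffAt hu).of_le (by norm_num)
  · filter_upwards [hg.eventually hleft, hT.eventually (h.image_invFunOn hu),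
      isOpen_ne.mem_nhds hy] with z hz1 hz2 hz3
    rw [hz2.2, (hspec z hz3).2] at hz1
    rw [Function.comp_apply, ContDiffAt.localInverse, hz1, hz2.2]

theorem fderiv_gaussInvExt (hE : IsOvaloid E) (hx : x ∈ E) {r : ℝ} (hr : 0 < r) :
    fderiv ℝ (gaussInvExt E) (r • outwardNormal E x) (outwardNormal E x) = 0 ∧
      ∀ v ∈ tangentPlane E x,
        fderiv ℝ (gaussInvExt E) (r • outwardNormal E x) (normalDeriv E x v) = r⁻¹ • v := by
  obtain ⟨U, φ, h, u, hu, rfl⟩ := hE.exists_localParam x hx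
  have hne : r • outwardNormal E (φ u) ≠ 0 := by
    rw [← norm_ne_zero_iff, norm_smul, hE.norm_outwardNormal hx, mul_one,
      Real.norm_of_nonneg hr.le]
    exact hr.ne'
  have h1 := ((hE.contDiffAt_gaussInvExt hne).differentiableAt one_ne_zero).hasFDerivAt
  have h2 := HasFDerivAt.comp (f := fun z : E2 × ℝ => z.2 • outwardNormal E (φ z.1)) (u, r) h1
    (hE.hasFDerivAt_cone h hu r)
  have h3 : HasFDerivAt (fun z : E2 × ℝ => φ z.1)
      (fderiv ℝ φ u ∘L ContinuousLinearMap.fst ℝ E2 ℝ) (u, r) :=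
    HasFDerivAt.comp (u, r) (h.hasFDerivAt hu) hasFDerivAt_fst
  have h4 : (gaussInvExt E ∘ fun z : E2 × ℝ => z.2 • outwardNormal E (φ z.1))
      =ᶠ[𝓝 (u, r)] fun z => φ z.1 := by
    filter_upwards [prod_mem_nhds (h.isOpen.mem_nhds hu) (lt_mem_nhds hr)] with z hz
    exact hE.gaussInvExt_cone h hz.1 hz.2
  have h5 := h2.unique (h3.congr_of_eventuallyEq h4)
  constructor
  · have := congrArg (fun l : E2 × ℝ →L[ℝ] E3 => l (0, 1)) h5
    simpa using this
  · intro v hv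
    rw [h.tangentPlane_eq hu] at hv
    obtain ⟨a, rfl⟩ := hv
    have := congrArg (fun l : E2 × ℝ →L[ℝ] E3 => l (a, 0)) h5
    simp only [ContinuousLinearMap.comp_apply, frame, ContinuousLinearMap.coprod_apply,
      smul_apply, map_zero, add_zero, map_smul,
      ContinuousLinearMap.coe_fst'] at this
    rw [ContinuousLinearMap.coe_coe, eq_inv_smul_iff₀ hr.ne']
    exact this

/-- The divergence of the extended inverse Gauss map is the sum of the radii of curvature, divided
by the distance to the origin. -/
theorem gaussianCurvature_mul_trace (hE : IsOvaloid E) (hx : x ∈ E) {r : ℝ} (hr : 0 < r) :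
    gaussianCurvature E x * LinearMap.trace ℝ E3
      (fderiv ℝ (gaussInvExt E) (r • outwardNormal E x) : E3 →ₗ[ℝ] E3)
      = r⁻¹ * (2 * meanCurvature E x) := by
  obtain ⟨b, hb⟩ := exists_orthonormalBasis_eq (hE.norm_outwardNormal hx)
  obtain ⟨hK, hH⟩ := hE.curvature_eq_of_frame hx b hb
  obtain ⟨hD2, hD⟩ := hE.fderiv_gaussInvExt hx hr
  set D := fderiv ℝ (gaussInvExt E) (r • outwardNormal E x)
  have hmem : ∀ i, i ≠ 2 → b i ∈ tangentPlane E x := fun i hi => by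
    rw [hE.mem_tangentPlane_iff hx, ← hb, b.inner_eq_ite, if_neg hi]
  have hdN : ∀ j, j ≠ 2 → normalDeriv E x (b j)
      = ⟪b 0, normalDeriv E x (b j)⟫ • b 0 + ⟪b 1, normalDeriv E x (b j)⟫ • b 1 := by
    intro j hj
    conv_lhs => rw [OrthonormalBasis.eq_sum_three b (normalDeriv E x (b j))]
    have : ⟪b 2, normalDeriv E x (b j)⟫ = 0 := by
      rw [hb, real_inner_comm]
      exact (hE.mem_tangentPlane_iff hx).1 (hE.normalDeriv_mem_tangentPlane hx (hmem j hj))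
    rw [this, zero_smul, add_zero]
  have hrel : ∀ i j, j ≠ 2 → ⟪b 0, normalDeriv E x (b j)⟫ * ⟪b i, D (b 0)⟫
      + ⟪b 1, normalDeriv E x (b j)⟫ * ⟪b i, D (b 1)⟫ = if i = j then r⁻¹ else 0 := by
    intro i j hj
    have h1 : ⟪b i, D (normalDeriv E x (b j))⟫ = ⟪b i, r⁻¹ • b j⟫ := by
      rw [hD (b j) (hmem j hj)]
    rw [hdN j hj, map_add, map_smul, map_smul, inner_add_right, real_inner_smul_right,
      real_inner_smul_right, real_inner_smul_right, b.inner_eq_ite] at h1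
    rw [h1]; split_ifs <;> simp
  rw [LinearMap.trace_eq_sum_inner _ b, Fin.sum_univ_three]
  simp only [ContinuousLinearMap.coe_coe]
  rw [hb, hD2, inner_zero_right, add_zero, hK, hH]
  have h00 := hrel 0 0 (by decide)
  have h01 := hrel 0 1 (by decide)
  have h10 := hrel 1 0 (by decide)
  have h11 := hrel 1 1 (by decide)
  simp only [if_true, zero_ne_one, one_ne_zero, if_false] at h00 h01 h10 h11
  linear_combination ⟪b 1, normalDeriv E x (b 1)⟫ * h00 - ⟪b 1, normalDeriv E x (b 0)⟫ * h01
    + ⟪b 0, normalDeriv E x (b 0)⟫ * h11 - ⟪b 0, normalDeriv E x (b 1)⟫ * h10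

end IsOvaloid

end

section

/-! ### Jacobian determinants -/

variable {E : Set E3} {U : Set E2} {φ : E2 → E3} {u : E2} {x w y : E3}

/-- The splitting of space into its first two coordinates and the last one. -/
noncomputable def splitLast : E3 ≃L[ℝ] E2 × ℝ :=
  LinearEquiv.toContinuousLinearEquiv
    { toFun := fun y => (!₂[y 0, y 1], y 2)
      invFun := fun z => !₂[z.1 0, z.1 1, z.2]
      map_add' := fun y z => by
        ext i
        · fin_cases i <;> simp
        · simp
      map_smul' := fun c y => by
        ext i
        · fin_cases i <;> simp
        · simp
      left_inv := fun y => by ext i; fin_cases i <;> rfl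
      right_inv := fun z => by
        ext i
        · fin_cases i <;> rfl
        · rfl }

theorem splitLast_apply (y : E3) : splitLast y = (!₂[y 0, y 1], y 2) := rfl

theorem measurePreserving_splitLast : MeasurePreserving splitLast := by
  have h1 := PiLp.volume_preserving_ofLp (Fin 3)
  have h2 := volume_preserving_piFinSuccAbove (fun _ : Fin 3 => ℝ) 2
  have h3 := Measure.measurePreserving_swap (μ := (volume : Measure ℝ))
    (ν := (volume : Measure (Fin 2 → ℝ)))
  have h4 := (PiLp.volume_preserving_toLp (Fin 2)).prod (MeasurePreserving.id (volume : Measure ℝ))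
  have h5 := h4.comp (h3.comp (h2.comp h1))
  convert h5 using 1
  · ext y i
    · fin_cases i <;> rfl
    · rfl
  · exact Measure.volume_eq_prod _ _

/-- The determinant of `(a, s) ↦ L a + s ν`, where the target space is identified with `E2 × ℝ` by
`splitLast`. -/
noncomputable def frameDet (L : E2 →L[ℝ] E3) (ν : E3) : ℝ :=
  ((splitLast : E3 →L[ℝ] E2 × ℝ) ∘L frame L ν).det

theorem abs_frameDet_eq_normDet {L : E2 →L[ℝ] E3} {ν : E3} (hν : ‖ν‖ = 1)
    (h : ∀ a, ⟪L a, ν⟫ = 0) : |frameDet L ν| = (L : E2 →ₗ[ℝ] E3).normDet := by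
  set F : E3 →ₗ[ℝ] E3 := (frame L ν : E2 × ℝ →ₗ[ℝ] E3) ∘ₗ (splitLast : E3 →ₗ[ℝ] E2 × ℝ) with hF
  have h1 : frameDet L ν = LinearMap.det F := by
    have := LinearMap.det_conj F splitLast.toLinearEquiv
    rw [← this]
    unfold frameDet
    rw [ContinuousLinearMap.det]
    congr 1
    ext z <;> simp [F]
  have h0 : F (EuclideanSpace.basisFun (Fin 3) ℝ 0) = L (EuclideanSpace.basisFun (Fin 2) ℝ 0) := by
    have : splitLast (EuclideanSpace.single 0 1) = (EuclideanSpace.single 0 1, 0) := by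
      ext i
      · fin_cases i <;> simp [splitLast_apply]
      · simp [splitLast_apply]
    simp [F, this]
  have h0' : F (EuclideanSpace.basisFun (Fin 3) ℝ 1) = L (EuclideanSpace.basisFun (Fin 2) ℝ 1) := by
    have : splitLast (EuclideanSpace.single 1 1) = (EuclideanSpace.single 1 1, 0) := by
      ext i
      · fin_cases i <;> simp [splitLast_apply]
      · simp [splitLast_apply]
    simp [F, this]
  have h0'' : F (EuclideanSpace.basisFun (Fin 3) ℝ 2) = ν := by
    have : splitLast (EuclideanSpace.single 2 1) = (0, 1) := by
      ext i
      · fin_cases i <;> simp [splitLast_apply]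
      · simp [splitLast_apply]
    simp [F, this]
  rw [h1, ← LinearMap.normDet_eq_abs_det, ← sq_eq_sq₀ (LinearMap.normDet_nonneg _)
    (LinearMap.normDet_nonneg _)]
  have g3 := F.normDet_sq_eq_det_gram (EuclideanSpace.basisFun (Fin 3) ℝ)
  have g2 := (L : E2 →ₗ[ℝ] E3).normDet_sq_eq_det_gram (EuclideanSpace.basisFun (Fin 2) ℝ)
  simp only [RCLike.ofReal_real_eq_id, id] at g2 g3
  rw [g2, g3, Matrix.det_fin_two, Matrix.det_fin_three]
  simp only [Matrix.gram_apply, h0, h0', h0'', h,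
    ContinuousLinearMap.coe_coe, real_inner_self_eq_norm_sq ν, hν]
  have h' : ∀ a, ⟪ν, L a⟫ = 0 := fun a => by rw [real_inner_comm, h]
  simp only [h']
  ring

theorem frameDet_smul (L : E2 →L[ℝ] E3) (ν : E3) (r : ℝ) :
    frameDet (r • L) ν = r ^ 2 * frameDet L ν := by
  have h : ((splitLast : E3 →L[ℝ] E2 × ℝ) ∘L frame (r • L) ν : E2 × ℝ →ₗ[ℝ] E2 × ℝ)
      = ((splitLast : E3 →L[ℝ] E2 × ℝ) ∘L frame L ν : E2 × ℝ →ₗ[ℝ] E2 × ℝ) ∘ₗ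
        LinearMap.prodMap (r • LinearMap.id) LinearMap.id := by
    ext z <;> simp
  rw [frameDet, ContinuousLinearMap.det, h, LinearMap.det_comp, LinearMap.det_prodMap,
    LinearMap.det_smul]
  simp [frameDet, ContinuousLinearMap.det, mul_comm]

/-- The Jacobian determinant of the Gauss map is the Gaussian curvature. -/
theorem IsOvaloid.frameDet_normalDeriv (hE : IsOvaloid E) (hx : x ∈ E) {L : E2 →L[ℝ] E3}
    (hL : ∀ a, L a ∈ tangentPlane E x) :
    frameDet (normalDeriv E x ∘L L) (outwardNormal E x)
      = gaussianCurvature E x * frameDet L (outwardNormal E x) := by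
  obtain ⟨b, hb⟩ := exists_orthonormalBasis_eq (hE.norm_outwardNormal hx)
  set N := outwardNormal E x
  -- the Weingarten map, extended by the identity on the normal line
  set G : E3 →ₗ[ℝ] E3 := (normalDeriv E x : E3 →ₗ[ℝ] E3) +
    LinearMap.smulRight (innerSL ℝ N : E3 →ₗ[ℝ] ℝ) (N - normalDeriv E x N) with hG
  have hGv : ∀ v, ⟪v, N⟫ = 0 → G v = normalDeriv E x v := fun v hv => by
    simp [G, real_inner_comm v N, hv]
  have hGN : G N = N := by
    simp [G, N, hE.norm_outwardNormal hx]
  have hdet : LinearMap.det G = gaussianCurvature E x := by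
    rw [(hE.curvature_eq_of_frame hx b hb).1, ← LinearMap.det_toMatrix b.toBasis,
      Matrix.det_fin_three]
    have hperp : ∀ i, i ≠ 2 → ⟪b i, N⟫ = 0 := fun i hi => by
      rw [← hb, b.inner_eq_ite, if_neg hi]
    have hmem : ∀ i, i ≠ 2 → ⟪N, normalDeriv E x (b i)⟫ = 0 := fun i hi => by
      rw [real_inner_comm]
      exact (hE.mem_tangentPlane_iff hx).1 (hE.normalDeriv_mem_tangentPlane hx
        ((hE.mem_tangentPlane_iff hx).2 (hperp i hi)))
    have hNN : ⟪N, N⟫ = 1 := by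
      rw [real_inner_self_eq_norm_sq, hE.norm_outwardNormal hx, one_pow]
    simp only [LinearMap.toMatrix_apply, OrthonormalBasis.coe_toBasis_repr_apply,
      OrthonormalBasis.repr_apply_apply, OrthonormalBasis.coe_toBasis, hb, hGN,
      hGv _ (hperp 0 (by decide)), hGv _ (hperp 1 (by decide)), hperp 0 (by decide),
      hperp 1 (by decide), hmem 0 (by decide), hmem 1 (by decide), hNN]
    ring
  have h : ((splitLast : E3 →L[ℝ] E2 × ℝ) ∘L frame (normalDeriv E x ∘L L) N :
        E2 × ℝ →ₗ[ℝ] E2 × ℝ)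
      = (splitLast.toLinearEquiv.toLinearMap ∘ₗ G ∘ₗ splitLast.toLinearEquiv.symm.toLinearMap) ∘ₗ
        ((splitLast : E3 →L[ℝ] E2 × ℝ) ∘L frame L N : E2 × ℝ →ₗ[ℝ] E2 × ℝ) := by
    apply LinearMap.ext
    rintro ⟨a, s⟩
    have := hGv (L a) ((hE.mem_tangentPlane_iff hx).1 (hL a))
    simp [this, hGN]
  rw [frameDet, ContinuousLinearMap.det, h, LinearMap.det_comp, LinearMap.det_conj, hdet]
  rfl

end

section

/-! ### Comparison of measures -/

variable {E : Set E3} {U : Set E2} {φ : E2 → E3} {u : E2} {x w y : E3}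

/-- An inequality between two measures that holds for the small subsets of a set holds for all of
its subsets. -/
theorem measure_le_of_locally_le {X : Type*} [TopologicalSpace X] [SecondCountableTopology X]
    [MeasurableSpace X] [OpensMeasurableSpace X] {μ ν : Measure X} {E : Set X}
    (h : ∀ x ∈ E, ∃ W ∈ 𝓝[E] x, ∀ A ⊆ W, MeasurableSet A → μ A ≤ ν A)
    {A : Set X} (hAE : A ⊆ E) (hA : MeasurableSet A) : μ A ≤ ν A := by
  have h' : ∀ x : X, ∃ V : Set X, IsOpen V ∧ (x ∈ E → x ∈ V ∧
      ∀ A ⊆ V ∩ E, MeasurableSet A → μ A ≤ ν A) := by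
    intro x
    by_cases hx : x ∈ E
    · obtain ⟨W, hW, hWA⟩ := h x hx
      obtain ⟨V, hV, hxV, hVW⟩ := mem_nhdsWithin.1 hW
      exact ⟨V, hV, fun _ => ⟨hxV, fun A hA => hWA A (hA.trans hVW)⟩⟩
    · exact ⟨∅, isOpen_empty, fun hx' => (hx hx').elim⟩
  choose V hVo hV using h'
  obtain ⟨t, htE, htc, ht⟩ := TopologicalSpace.countable_cover_nhdsWithin (s := E) (f := V)
    fun x hx => mem_nhdsWithin_of_mem_nhds ((hVo x).mem_nhds (hV x hx).1)
  rcases t.eq_empty_or_nonempty with rfl | hne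
  · have : A = ∅ := subset_empty_iff.1 (hAE.trans (by simpa using ht))
    simp [this]
  obtain ⟨f, rfl⟩ := htc.exists_eq_range hne
  rw [biUnion_range, ← iUnion_disjointed] at ht
  have hAU : A = ⋃ n, A ∩ disjointed (fun n => V (f n)) n := by
    rw [← inter_iUnion]; exact (inter_eq_left.2 (hAE.trans ht)).symm
  have hm : ∀ n, MeasurableSet (A ∩ disjointed (fun n => V (f n)) n) := fun n =>
    hA.inter (MeasurableSet.disjointed (fun n => (hVo _).measurableSet) n)
  have hd : Pairwise (Function.onFun Disjoint fun n => A ∩ disjointed (fun n => V (f n)) n) :=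
    fun i j hij => (disjoint_disjointed _ hij).mono inter_subset_right inter_subset_right
  rw [hAU, measure_iUnion hd hm, measure_iUnion hd hm]
  refine ENNReal.tsum_le_tsum fun n => ?_
  refine (hV (f n) (htE (mem_range_self n))).2 _ ?_ (hm n)
  exact fun z hz => ⟨disjointed_subset (fun n => V (f n)) n hz.2, hAE hz.1⟩

/-- A map that expands distances at most `c` times as much as another one has images whose area is
at most `c ^ 2` times as large. -/
theorem euclideanHausdorffMeasure_image_le {X Y Z : Type*} [MetricSpace Y] [MeasurableSpace Y]
    [BorelSpace Y] [MetricSpace Z] [MeasurableSpace Z] [BorelSpace Z] [Nonempty X] {f : X → Y}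
    {g : X → Z} {s : Set X} {c : NNReal}
    (h : ∀ a ∈ s, ∀ b ∈ s, dist (f a) (f b) ≤ c * dist (g a) (g b)) :
    Measure.euclideanHausdorffMeasure 2 (f '' s)
      ≤ (c : ENNReal) ^ 2 * Measure.euclideanHausdorffMeasure 2 (g '' s) := by
  have hinv : ∀ a ∈ s, Function.invFunOn g s (g a) ∈ s ∧
      g (Function.invFunOn g s (g a)) = g a := fun a ha =>
    Function.invFunOn_pos ⟨a, ha, rfl⟩
  have hlip : LipschitzOnWith c (f ∘ Function.invFunOn g s) (g '' s) := by
    refine LipschitzOnWith.of_dist_le_mul ?_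
    rintro _ ⟨a, ha, rfl⟩ _ ⟨b, hb, rfl⟩
    have := h _ (hinv a ha).1 _ (hinv b hb).1
    rwa [(hinv a ha).2, (hinv b hb).2] at this
  have himg : (f ∘ Function.invFunOn g s) '' (g '' s) = f '' s := by
    rw [image_image]
    refine image_congr fun a ha => ?_
    have := h _ (hinv a ha).1 _ ha
    rw [(hinv a ha).2, dist_self, mul_zero] at this
    exact dist_le_zero.1 this
  have := hlip.hausdorffMeasure_image_le (d := 2) (by norm_num)
  rw [himg] at this
  simp only [Measure.euclideanHausdorffMeasure_def, Measure.smul_apply, Nat.cast_ofNat,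
    ENNReal.smul_def, smul_eq_mul]
  calc _ ≤ _ := mul_le_mul_right this _
    _ = _ := by rw [ENNReal.rpow_ofNat]; ring

/-- Near a point, a parametrization distorts areas like its differential, up to a factor close to
one. -/
theorem IsLocalParam.eventually_area_le (h : IsLocalParam E U φ) (hu : u ∈ U) {c : NNReal}
    (hc : 1 < c) : ∀ᶠ V in (𝓝 u).smallSets, ∀ A ⊆ V,
      Measure.euclideanHausdorffMeasure 2 (φ '' A)
        ≤ (c : ENNReal) ^ 2 * (ENNReal.ofReal (fderiv ℝ φ u : E2 →ₗ[ℝ] E3).normDet * volume A) ∧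
      ENNReal.ofReal (fderiv ℝ φ u : E2 →ₗ[ℝ] E3).normDet * volume A
        ≤ (c : ENNReal) ^ 2 * Measure.euclideanHausdorffMeasure 2 (φ '' A) := by
  have hc' : (1 : ℝ) < c := by exact_mod_cast hc
  have hε : (0 : ℝ) < 1 - (c : ℝ)⁻¹ := by
    have := inv_lt_one_of_one_lt₀ hc'; linarith
  have h1 := h.norm_sub_sub_le hu hε
  rw [nhds_prod_eq] at h1
  obtain ⟨T, hT, hTT⟩ := eventually_prod_self_iff (r := fun a b =>
    ‖φ a - φ b - fderiv ℝ φ u (a - b)‖ ≤ (1 - (c : ℝ)⁻¹) * ‖φ a - φ b‖) |>.1 h1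
  refine eventually_smallSets.2 ⟨T, hT, fun V hV A hA => ?_⟩
  have h2 := LinearMap.euclideanHausdorffMeasure_image_eq_normDet_mul_volume
    (fderiv ℝ φ u : E2 →ₗ[ℝ] E3) A
  rw [show Module.finrank ℝ E2 = 2 by simp] at h2
  rw [← h2]
  constructor
  · refine euclideanHausdorffMeasure_image_le fun a ha b hb => ?_
    have h3 := hTT a (hV (hA ha)) b (hV (hA hb))
    rw [dist_eq_norm, dist_eq_norm, ← map_sub]
    have h4 : ‖φ a - φ b‖ ≤ ‖φ a - φ b - fderiv ℝ φ u (a - b)‖ + ‖fderiv ℝ φ u (a - b)‖ := by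
      have := norm_add_le (φ a - φ b - fderiv ℝ φ u (a - b)) (fderiv ℝ φ u (a - b))
      simpa using this
    have h5 : (c : ℝ)⁻¹ * ‖φ a - φ b‖ ≤ ‖fderiv ℝ φ u (a - b)‖ := by linarith
    rwa [inv_mul_le_iff₀ (by linarith)] at h5
  · refine euclideanHausdorffMeasure_image_le fun a ha b hb => ?_
    have h3 := hTT a (hV (hA ha)) b (hV (hA hb))
    rw [dist_eq_norm, dist_eq_norm, ← map_sub]
    have h4 : ‖fderiv ℝ φ u (a - b)‖ ≤ ‖φ a - φ b‖ + ‖φ a - φ b - fderiv ℝ φ u (a - b)‖ := by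
      have := norm_sub_le (φ a - φ b) (φ a - φ b - fderiv ℝ φ u (a - b))
      simpa using this
    have h6 : 2 - (c : ℝ)⁻¹ ≤ c := by
      have : (c : ℝ) * (c : ℝ)⁻¹ = 1 := mul_inv_cancel₀ (by linarith)
      nlinarith [mul_pos hε hε, sq_nonneg ((c : ℝ) - 1)]
    calc _ ≤ (2 - (c : ℝ)⁻¹) * ‖φ a - φ b‖ := by
          change ‖fderiv ℝ φ u (a - b)‖ ≤ _
          linarith
      _ ≤ _ := by gcongr

/-! ### The Gauss map and the area elements -/

namespace IsOvaloid

/-- The Jacobian determinant of the Gauss map in a parametrization. -/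
noncomputable def gaussJacobian (E : Set E3) (φ : E2 → E3) (u : E2) : ℝ :=
  frameDet (normalDeriv E (φ u) ∘L fderiv ℝ φ u) (outwardNormal E (φ u))

theorem continuousAt_frameDet {L : E2 → E2 →L[ℝ] E3} {ν : E2 → E3} (hL : ContinuousAt L u)
    (hν : ContinuousAt ν u) : ContinuousAt (fun v => frameDet (L v) (ν v)) u := by
  have h1 : ContinuousAt (fun v => frame (L v) (ν v)) u := by
    have h : (fun v => frame (L v) (ν v)) = fun v => (L v) ∘L ContinuousLinearMap.fst ℝ E2 ℝ +
        (ContinuousLinearMap.smulRightL ℝ (E2 × ℝ) E3 (ContinuousLinearMap.snd ℝ E2 ℝ)) (ν v) := by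
      ext q x <;> simp [frame]
    rw [h]
    exact (hL.clm_comp continuousAt_const).add
      ((ContinuousLinearMap.continuous _).continuousAt.comp hν)
  exact ContinuousLinearMap.continuous_det.continuousAt.comp (continuousAt_const.clm_comp h1)

theorem continuousAt_normalDeriv_comp (hE : IsOvaloid E) (h : IsLocalParam E U φ) (hu : u ∈ U) :
    ContinuousAt (fun v => normalDeriv E (φ v) ∘L fderiv ℝ φ v) u := by
  have h1 : ContinuousAt (fderiv ℝ (fun v => outwardNormal E (φ v))) u :=
    ((hE.contDiffAt_outwardNormal_comp h hu).fderiv_right (m := 0) (by norm_num)).continuousAt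
  refine h1.congr ?_
  filter_upwards [h.isOpen.mem_nhds hu] with v hv
  exact (hE.hasFDerivAt_outwardNormal_comp h hv).fderiv

theorem continuousAt_gaussJacobian (hE : IsOvaloid E) (h : IsLocalParam E U φ) (hu : u ∈ U) :
    ContinuousAt (gaussJacobian E φ) u :=
  continuousAt_frameDet (hE.continuousAt_normalDeriv_comp h hu)
    (hE.hasFDerivAt_outwardNormal_comp h hu).continuousAt

theorem gaussJacobian_eq (hE : IsOvaloid E) (h : IsLocalParam E U φ) (hu : u ∈ U) :
    gaussJacobian E φ u = gaussianCurvature E (φ u) *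
      frameDet (fderiv ℝ φ u) (outwardNormal E (φ u)) :=
  hE.frameDet_normalDeriv (h.mapsTo hu) fun a => by
    rw [h.tangentPlane_eq hu]; exact ⟨a, rfl⟩

theorem abs_gaussJacobian (hE : IsOvaloid E) (h : IsLocalParam E U φ) (hu : u ∈ U) :
    |gaussJacobian E φ u| = gaussianCurvature E (φ u) * (fderiv ℝ φ u : E2 →ₗ[ℝ] E3).normDet := by
  rw [hE.gaussJacobian_eq h hu, abs_mul, abs_of_pos (hE.gaussianCurvature_pos _ (h.mapsTo hu)),
    abs_frameDet_eq_normDet (hE.norm_outwardNormal (h.mapsTo hu))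
      (hE.inner_fderiv_outwardNormal h hu)]

theorem normDet_fderiv_pos (h : IsLocalParam E U φ) (hu : u ∈ U) :
    0 < (fderiv ℝ φ u : E2 →ₗ[ℝ] E3).normDet := by
  refine (LinearMap.normDet_nonneg _).lt_of_ne' ?_
  exact ((LinearMap.normDet_ne_zero_tfae _).out 0 4).2 (h.immersion u hu)

theorem continuousOn_gaussianCurvature (hE : IsOvaloid E) :
    ContinuousOn (gaussianCurvature E) E := by
  intro x hx
  obtain ⟨U, φ, h, u, hu, rfl⟩ := hE.exists_localParam x hx
  have h1 : ContinuousAt (fun v => frameDet (fderiv ℝ φ v) (outwardNormal E (φ v))) u :=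
    continuousAt_frameDet ((h.contDiffAt hu).fderiv_right (m := 1) (by norm_num)).continuousAt
      (hE.hasFDerivAt_outwardNormal_comp h hu).continuousAt
  have hne : ∀ v ∈ U, frameDet (fderiv ℝ φ v) (outwardNormal E (φ v)) ≠ 0 := fun v hv h0 => by
    have h2 := abs_frameDet_eq_normDet (hE.norm_outwardNormal (h.mapsTo hv))
      (hE.inner_fderiv_outwardNormal h hv)
    rw [h0, abs_zero] at h2
    exact (normDet_fderiv_pos h hv).ne h2
  have h2 := (hE.continuousAt_gaussJacobian h hu).div h1 (hne u hu)
  have h3 : Tendsto (fun v => gaussianCurvature E (φ v)) (𝓝 u) (𝓝 (gaussianCurvature E (φ u))) := by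
    have h4 : ContinuousAt (fun v => gaussianCurvature E (φ v)) u := by
      refine h2.congr ?_
      filter_upwards [h.isOpen.mem_nhds hu] with v hv
      rw [Pi.div_apply, hE.gaussJacobian_eq h hv, mul_div_cancel_right₀ _ (hne v hv)]
    exact h4
  refine (h3.comp (h.tendsto_invFunOn hu)).congr' ?_
  filter_upwards [h.image_invFunOn hu] with y hy
  rw [Function.comp_apply, hy.2]

/-- The volume of the cone over a piece of the spherical image, by the change of variables
`(v, r) ↦ r N (φ v)`. -/
theorem volume_cone (hE : IsOvaloid E) (h : IsLocalParam E U φ) {A : Set E2} (hAU : A ⊆ U)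
    (hA : MeasurableSet A) :
    volume ((fun z : E2 × ℝ => z.2 • outwardNormal E (φ z.1)) '' (A ×ˢ Ioo 0 1))
      = ∫⁻ z in A ×ˢ Ioo 0 1, ENNReal.ofReal (z.2 ^ 2 * |gaussJacobian E φ z.1|) := by
  set C : E2 × ℝ → E3 := fun z => z.2 • outwardNormal E (φ z.1) with hC
  have hinj : InjOn (splitLast ∘ C) (A ×ˢ Ioo 0 1) := by
    refine splitLast.injective.comp_injOn ?_
    rintro ⟨v, r⟩ ⟨hv, hr⟩ ⟨v', r'⟩ ⟨hv', hr'⟩ heq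
    simp only [C] at heq hv hr hv' hr'
    have hn : ‖r • outwardNormal E (φ v)‖ = ‖r' • outwardNormal E (φ v')‖ := by rw [heq]
    rw [norm_smul, norm_smul, hE.norm_outwardNormal (h.mapsTo (hAU hv)),
      hE.norm_outwardNormal (h.mapsTo (hAU hv')), mul_one, mul_one,
      Real.norm_of_nonneg hr.1.le, Real.norm_of_nonneg hr'.1.le] at hn
    subst hn
    rw [h.injOn (hAU hv) (hAU hv') (hE.injOn_outwardNormal (h.mapsTo (hAU hv))
      (h.mapsTo (hAU hv')) (smul_right_injective E3 hr.1.ne' heq))]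
  have hder : ∀ z ∈ A ×ˢ Ioo (0 : ℝ) 1, HasFDerivWithinAt (splitLast ∘ C)
      ((splitLast : E3 →L[ℝ] E2 × ℝ) ∘L frame (z.2 • (normalDeriv E (φ z.1) ∘L fderiv ℝ φ z.1))
        (outwardNormal E (φ z.1))) (A ×ˢ Ioo 0 1) z := by
    rintro ⟨v, r⟩ ⟨hv, hr⟩
    exact (splitLast.hasFDerivAt.comp (v, r)
      (hE.hasFDerivAt_cone h (hAU hv) r)).hasFDerivWithinAt
  have : (volume : Measure (E2 × ℝ)).IsAddHaarMeasure :=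
    inferInstanceAs ((volume : Measure E2).prod (volume : Measure ℝ)).IsAddHaarMeasure
  have h1 := lintegral_abs_det_fderiv_eq_addHaar_image volume (hA.prod measurableSet_Ioo) hder hinj
  have h2 : volume (C '' (A ×ˢ Ioo 0 1)) = volume ((splitLast ∘ C) '' (A ×ˢ Ioo 0 1)) := by
    rw [image_comp, ← measurePreserving_splitLast.measure_preimage_emb
      splitLast.toHomeomorph.measurableEmbedding, preimage_image_eq _ splitLast.injective]
  rw [h2, ← h1]
  refine lintegral_congr fun z => ?_
  have h3 := frameDet_smul (normalDeriv E (φ z.1) ∘L fderiv ℝ φ z.1) (outwardNormal E (φ z.1)) z.2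
  rw [frameDet] at h3
  rw [h3, abs_mul, abs_of_nonneg (sq_nonneg z.2)]
  rfl

end IsOvaloid

end

section

variable {E : Set E3} {U : Set E2} {φ : E2 → E3} {u : E2} {x w y : E3}

theorem lintegral_sq_prod_Ioo (A : Set E2) :
    ∫⁻ z in A ×ˢ Ioo (0 : ℝ) 1, ENNReal.ofReal (z.2 ^ 2) = volume A * ENNReal.ofReal (1 / 3) := by
  have h1 : ∫⁻ r in Ioo (0 : ℝ) 1, ENNReal.ofReal (r ^ 2) = ENNReal.ofReal (1 / 3) := by
    rw [← ofReal_integral_eq_lintegral_ofReal, ← integral_Ioc_eq_integral_Ioo,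
      ← intervalIntegral.integral_of_le zero_le_one, integral_pow]
    · norm_num
    · exact ((continuous_pow 2).integrableOn_Icc (a := 0) (b := 1)).mono_set Ioo_subset_Icc_self
    · exact ae_of_all _ fun r => sq_nonneg r
  rw [Measure.volume_eq_prod, ← Measure.prod_restrict]
  have h2 := lintegral_prod_mul (μ := (volume : Measure E2).restrict A)
    (ν := (volume : Measure ℝ).restrict (Ioo 0 1)) (f := fun _ => 1)
    (g := fun r => ENNReal.ofReal (r ^ 2)) (by fun_prop) (by fun_prop)
  simp only [one_mul] at h2
  rw [h2, h1]
  simp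

theorem eventually_le_mul_of_continuousAt {X : Type*} [TopologicalSpace X] {f : X → ℝ} {a : X}
    (hf : ContinuousAt f a) (ha : 0 < f a) {c : ℝ} (hc : 1 < c) :
    ∀ᶠ b in 𝓝 a, f b ≤ c * f a ∧ f a ≤ c * f b := by
  have h1 := hf.eventually (ge_mem_nhds (show f a < c * f a by nlinarith))
  have h2 := (continuousAt_const.mul hf).eventually (le_mem_nhds (show f a < c * f a by nlinarith))
  exact h1.and h2

namespace IsOvaloid

/-- The area of the spherical image, as a measure on the surface. -/
noncomputable def gaussMeasure (E : Set E3) : Measure E3 :=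
  (volume : Measure E3).toSphere.map fun w : Metric.sphere (0 : E3) 1 => gaussInv E w

theorem continuous_gaussInv (hE : IsOvaloid E) :
    Continuous fun w : Metric.sphere (0 : E3) 1 => gaussInv E w :=
  continuousOn_iff_continuous_domRestrict.1 hE.continuousOn_gaussInv

theorem gaussMeasure_image (hE : IsOvaloid E) (h : IsLocalParam E U φ) {A : Set E2} (hAU : A ⊆ U)
    (hA : MeasurableSet (φ '' A)) :
    gaussMeasure E (φ '' A)
      = 3 * volume ((fun z : E2 × ℝ => z.2 • outwardNormal E (φ z.1)) '' (A ×ˢ Ioo 0 1)) := by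
  rw [gaussMeasure, Measure.map_apply hE.continuous_gaussInv.measurable hA,
    Measure.toSphere_apply' _ (hE.continuous_gaussInv.measurable hA)]
  congr 2
  · simp
  · ext z
    simp only [Set.mem_smul, mem_image, mem_preimage, mem_prod, Prod.exists, Subtype.exists]
    constructor
    · rintro ⟨r, hr, w, ⟨w', hw', ⟨v, hv, hvw⟩, rfl⟩, rfl⟩
      refine ⟨v, r, ⟨hv, hr⟩, ?_⟩
      rw [hvw, (hE.gaussInv_spec (mem_sphere_zero_iff_norm.1 hw')).2]
    · rintro ⟨v, r, ⟨hv, hr⟩, rfl⟩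
      have hvE := h.mapsTo (hAU hv)
      exact ⟨r, hr, _, ⟨_, mem_sphere_zero_iff_norm.2 (hE.norm_outwardNormal hvE),
        ⟨v, hv, (hE.gaussInv_outwardNormal hvE).symm⟩, rfl⟩, rfl⟩

/-- The area of the spherical image of a small piece of the surface is close to the Gaussian
curvature times the area of the piece. -/
theorem exists_gaussMeasure_le (hE : IsOvaloid E) (hx : x ∈ E) {c : NNReal} (hc : 1 < c) :
    ∃ W ∈ 𝓝[E] x, ∀ A ⊆ W, MeasurableSet A →
      gaussMeasure E A ≤ (c : ENNReal) ^ 4 *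
        (∫⁻ y in A, ENNReal.ofReal (gaussianCurvature E y) ∂Measure.euclideanHausdorffMeasure 2) ∧
      (∫⁻ y in A, ENNReal.ofReal (gaussianCurvature E y) ∂Measure.euclideanHausdorffMeasure 2)
        ≤ (c : ENNReal) ^ 4 * gaussMeasure E A := by
  obtain ⟨U, φ, h, u, hu, rfl⟩ := hE.exists_localParam x hx
  have hc' : (1 : ℝ) < c := by exact_mod_cast hc
  have hK := hE.gaussianCurvature_pos _ hx
  have hJ := normDet_fderiv_pos h hu
  obtain ⟨T, hT, hTA⟩ := eventually_smallSets.1 (h.eventually_area_le hu hc)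
  have hKc : ContinuousAt (fun v => gaussianCurvature E (φ v)) u := by
    have h1 : Tendsto φ (𝓝 u) (𝓝[E] (φ u)) := by
      refine tendsto_nhdsWithin_iff.2 ⟨(h.hasFDerivAt hu).continuousAt, ?_⟩
      filter_upwards [h.isOpen.mem_nhds hu] with v hv using h.mapsTo hv
    exact (hE.continuousOn_gaussianCurvature _ hx).tendsto.comp h1
  have hd0 : 0 < |gaussJacobian E φ u| := by rw [hE.abs_gaussJacobian h hu]; positivity
  have ev1 := eventually_le_mul_of_continuousAt hKc hK hc'
  have ev2 := eventually_le_mul_of_continuousAt (f := fun v => |gaussJacobian E φ v|)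
    (hE.continuousAt_gaussJacobian h hu).abs hd0 hc'
  obtain ⟨V, hV, hVo, huV⟩ := mem_nhds_iff.1
    (((ev1.and ev2).and hT).and (h.isOpen.mem_nhds hu))
  have hVU : V ⊆ U := fun v hv => (hV hv).2
  refine ⟨φ '' (V ∩ U), h.image_mem_nhdsWithin hu (hVo.mem_nhds huV), fun A hA hAm => ?_⟩
  set A' := V ∩ φ ⁻¹' A with hA'
  have himg : φ '' A' = A := by
    apply subset_antisymm
    · rintro _ ⟨v, hv, rfl⟩; exact hv.2
    · intro a ha
      obtain ⟨v, hv, rfl⟩ := hA ha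
      exact ⟨v, ⟨hv.1, ha⟩, rfl⟩
  have hA'm : MeasurableSet A' := by
    classical
    have hm : Measurable (V.piecewise φ 0) :=
      (h.contDiffOn.continuousOn.mono hVU).measurable_piecewise continuousOn_const hVo.measurableSet
    have : A' = V ∩ V.piecewise φ 0 ⁻¹' A := by
      ext v
      refine and_congr_right fun hv => ?_
      rw [mem_preimage, mem_preimage, piecewise_eq_of_mem _ _ _ hv]
    rw [this]
    exact hVo.measurableSet.inter (hm hAm)
  have hA'V : A' ⊆ V := inter_subset_left
  set k := ENNReal.ofReal (gaussianCurvature E (φ u)) with hk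
  set j := ENNReal.ofReal (fderiv ℝ φ u : E2 →ₗ[ℝ] E3).normDet with hj
  set a := (Measure.euclideanHausdorffMeasure 2 : Measure E3) A with ha
  have hkj : ENNReal.ofReal |gaussJacobian E φ u| = k * j := by
    rw [hE.abs_gaussJacobian h hu, ENNReal.ofReal_mul hK.le]
  have hcc : (c : ENNReal) = ENNReal.ofReal c := (ENNReal.ofReal_coe_nnreal).symm
  -- areas in the surface and in the parameter domain
  obtain ⟨a1, a2⟩ := hTA T subset_rfl A' fun v hv => (hV (hA'V hv)).1.2
  rw [himg] at a1 a2
  -- the spherical image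
  have hs : gaussMeasure E A = 3 * ∫⁻ z in A' ×ˢ Ioo 0 1,
      ENNReal.ofReal (z.2 ^ 2) * ENNReal.ofReal |gaussJacobian E φ z.1| := by
    rw [← himg, hE.gaussMeasure_image h (hA'V.trans hVU) (himg.symm ▸ hAm),
      hE.volume_cone h (hA'V.trans hVU) hA'm]
    simp only [ENNReal.ofReal_mul (sq_nonneg _)]
  have h3 : (3 : ENNReal) * ENNReal.ofReal (1 / 3) = 1 := by
    rw [← ENNReal.ofReal_ofNat, ← ENNReal.ofReal_mul (by norm_num)]; norm_num
  have hint : ∀ b : ENNReal, 3 * ∫⁻ z in A' ×ˢ Ioo (0 : ℝ) 1, ENNReal.ofReal (z.2 ^ 2) * b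
      = volume A' * b := fun b => by
    rw [lintegral_mul_const _ (by fun_prop), lintegral_sq_prod_Ioo]
    calc _ = volume A' * b * (3 * ENNReal.ofReal (1 / 3)) := by ring
      _ = _ := by rw [h3, mul_one]
  have hprod : MeasurableSet (A' ×ˢ Ioo (0 : ℝ) 1) := hA'm.prod measurableSet_Ioo
  have s1 : gaussMeasure E A ≤ c * (k * j) * volume A' := by
    rw [hs, mul_comm (_ * _) (volume A'), ← hint]
    refine mul_le_mul_right (setLIntegral_mono' hprod fun z hz => ?_) _
    rw [← hkj, hcc, ← ENNReal.ofReal_mul c.coe_nonneg]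
    exact mul_le_mul_right (ENNReal.ofReal_le_ofReal (hV (hA'V hz.1)).1.1.2.1) _
  have s2 : (k * j) * volume A' ≤ c * gaussMeasure E A := by
    rw [hs, mul_comm (k * j) (volume A'), ← hint, mul_left_comm,
      ← lintegral_const_mul' _ _ ENNReal.coe_ne_top]
    refine mul_le_mul_right (setLIntegral_mono' hprod fun z hz => ?_) _
    rw [← hkj, mul_left_comm, hcc, ← ENNReal.ofReal_mul c.coe_nonneg]
    exact mul_le_mul_right (ENNReal.ofReal_le_ofReal (hV (hA'V hz.1)).1.1.2.2) _
  -- the curvature integral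
  have hKA : ∀ y ∈ A, gaussianCurvature E y ≤ c * gaussianCurvature E (φ u) ∧
      gaussianCurvature E (φ u) ≤ c * gaussianCurvature E y := by
    intro y hy
    rw [← himg] at hy
    obtain ⟨v, hv, rfl⟩ := hy
    exact (hV (hA'V hv)).1.1.1
  have k1 : (∫⁻ y in A, ENNReal.ofReal (gaussianCurvature E y)
      ∂Measure.euclideanHausdorffMeasure 2) ≤ c * k * a := by
    rw [ha, ← setLIntegral_const]
    refine setLIntegral_mono' hAm fun y hy => ?_
    rw [hcc, ← ENNReal.ofReal_mul (by positivity)]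
    exact ENNReal.ofReal_le_ofReal (hKA y hy).1
  have k2 : k * a ≤ c * ∫⁻ y in A, ENNReal.ofReal (gaussianCurvature E y)
      ∂Measure.euclideanHausdorffMeasure 2 := by
    rw [ha, ← setLIntegral_const, ← lintegral_const_mul' _ _ (by simp)]
    refine setLIntegral_mono' hAm fun y hy => ?_
    rw [hcc, ← ENNReal.ofReal_mul (by positivity)]
    exact ENNReal.ofReal_le_ofReal (hKA y hy).2
  constructor
  · calc gaussMeasure E A ≤ c * (k * j) * volume A' := s1
      _ = c * k * (j * volume A') := by ring
      _ ≤ c * k * ((c : ENNReal) ^ 2 * a) := by gcongr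
      _ = (c : ENNReal) ^ 3 * (k * a) := by ring
      _ ≤ (c : ENNReal) ^ 3 * (c * _) := by gcongr
      _ = _ := by ring
  · calc _ ≤ c * k * a := k1
      _ ≤ c * k * ((c : ENNReal) ^ 2 * (j * volume A')) := by gcongr
      _ = (c : ENNReal) ^ 3 * ((k * j) * volume A') := by ring
      _ ≤ (c : ENNReal) ^ 3 * (c * gaussMeasure E A) := by gcongr
      _ = _ := by ring

/-- The Gauss map transforms the area element, multiplied by the Gaussian curvature, into the area
element of the sphere. -/
theorem gaussMeasure_eq (hE : IsOvaloid E) :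
    gaussMeasure E = ((Measure.euclideanHausdorffMeasure 2).restrict E).withDensity
      fun y => ENNReal.ofReal (gaussianCurvature E y) := by
  have hEm : MeasurableSet E := hE.isCompact.isClosed.measurableSet
  set ν : Measure E3 := (Measure.euclideanHausdorffMeasure 2).withDensity
    fun y => ENNReal.ofReal (gaussianCurvature E y) with hν
  have hν_apply : ∀ A, MeasurableSet A → ν A = ∫⁻ y in A, ENNReal.ofReal (gaussianCurvature E y)
      ∂Measure.euclideanHausdorffMeasure 2 := fun A hA => withDensity_apply _ hA
  have hle : ∀ c : NNReal, 1 < c → ∀ A ⊆ E, MeasurableSet A →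
      gaussMeasure E A ≤ (c : ENNReal) ^ 4 * ν A ∧ ν A ≤ (c : ENNReal) ^ 4 * gaussMeasure E A := by
    intro c hc A hAE hA
    constructor
    · refine measure_le_of_locally_le (ν := (c : ENNReal) ^ 4 • ν) (fun x hx => ?_) hAE hA
      obtain ⟨W, hW, hWA⟩ := hE.exists_gaussMeasure_le hx hc
      refine ⟨W, hW, fun B hB hBm => ?_⟩
      rw [Measure.smul_apply, smul_eq_mul, hν_apply B hBm]
      exact (hWA B hB hBm).1
    · refine measure_le_of_locally_le (ν := (c : ENNReal) ^ 4 • gaussMeasure E)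
        (fun x hx => ?_) hAE hA
      obtain ⟨W, hW, hWA⟩ := hE.exists_gaussMeasure_le hx hc
      refine ⟨W, hW, fun B hB hBm => ?_⟩
      rw [Measure.smul_apply, smul_eq_mul, hν_apply B hBm]
      exact (hWA B hB hBm).2
  have hlim : ∀ a b : ENNReal, (∀ c : NNReal, 1 < c → a ≤ (c : ENNReal) ^ 4 * b) → a ≤ b := by
    intro a b hab
    have h1 : Tendsto (fun c : NNReal => (c : ENNReal) ^ 4 * b) (𝓝[>] 1) (𝓝 (1 * b)) := by
      refine ENNReal.Tendsto.mul_const ?_ (Or.inl one_ne_zero)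
      have : Continuous fun c : NNReal => (c : ENNReal) ^ 4 :=
        (ENNReal.continuous_pow 4).comp ENNReal.continuous_coe
      simpa using (this.tendsto 1).mono_left nhdsWithin_le_nhds
    rw [one_mul] at h1
    exact ge_of_tendsto h1 (by filter_upwards [self_mem_nhdsWithin] with c hc using hab c hc)
  have heq : ∀ A ⊆ E, MeasurableSet A → gaussMeasure E A = ν A := fun A hAE hA =>
    le_antisymm (hlim _ _ fun c hc => (hle c hc A hAE hA).1)
      (hlim _ _ fun c hc => (hle c hc A hAE hA).2)
  have hnull : gaussMeasure E Eᶜ = 0 := by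
    rw [gaussMeasure, Measure.map_apply hE.continuous_gaussInv.measurable hEm.compl]
    convert measure_empty (μ := (volume : Measure E3).toSphere)
    ext w
    simpa using (hE.gaussInv_spec (mem_sphere_zero_iff_norm.1 w.2)).1
  rw [← restrict_withDensity hEm]
  ext A hA
  rw [Measure.restrict_apply hA, ← heq _ inter_subset_right (hA.inter hEm)]
  refine le_antisymm ?_ (measure_mono inter_subset_left)
  calc gaussMeasure E A ≤ gaussMeasure E (A ∩ E) + gaussMeasure E (A \ E) :=
        measure_le_inter_add_sdiff _ _ _
    _ ≤ gaussMeasure E (A ∩ E) + gaussMeasure E Eᶜ := by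
        gcongr; exact fun z hz => hz.2
    _ = _ := by rw [hnull, add_zero]

end IsOvaloid

end

section

/-! ### Polar coordinates -/

theorem lintegral_eq_lintegral_sphere {F : E3 → ENNReal} (hF : Measurable F) :
    ∫⁻ y, F y = ∫⁻ w : Metric.sphere (0 : E3) 1, (∫⁻ r in Ioi (0 : ℝ),
      ENNReal.ofReal (r ^ 2) * F (r • (w : E3))) ∂(volume : Measure E3).toSphere := by
  have hm : Measurable fun z : Metric.sphere (0 : E3) 1 × Ioi (0 : ℝ) =>
      F ((z.2 : ℝ) • (z.1 : E3)) := by fun_prop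
  have h1 : ∫⁻ y, F y = ∫⁻ y : ({0}ᶜ : Set E3), F y ∂(Measure.comap Subtype.val volume) := by
    rw [lintegral_subtype_comap (measurableSet_singleton _).compl, restrict_compl_singleton]
  have h2 := (volume : Measure E3).measurePreserving_homeomorphUnitSphereProd.lintegral_comp_emb
    (Homeomorph.measurableEmbedding _) fun z => F ((z.2 : ℝ) • (z.1 : E3))
  have h3 : ∀ y : ({0}ᶜ : Set E3), ((homeomorphUnitSphereProd E3 y).2 : ℝ) •
      ((homeomorphUnitSphereProd E3 y).1 : E3) = y := fun y => by
    have hy : ‖(y : E3)‖ ≠ 0 := norm_ne_zero_iff.2 y.2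
    simp [smul_smul, hy]
  simp only [h3] at h2
  rw [h1, h2, lintegral_prod _ hm.aemeasurable]
  refine lintegral_congr fun w => ?_
  simp only [Measure.volumeIoiPow]
  rw [lintegral_withDensity_eq_lintegral_mul _ (by fun_prop) (by fun_prop)]
  simp only [Pi.mul_apply, finrank_euclideanSpace, Fintype.card_fin, Nat.add_one_sub_one]
  exact lintegral_subtype_comap measurableSet_Ioi
    fun r : ℝ => ENNReal.ofReal (r ^ 2) * F (r • (w : E3))

theorem integral_norm_mul_eq_integral_sphere (f : ℝ → ℝ) (g : E3 → ℝ) :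
    ∫ y : E3, f ‖y‖ * g (‖y‖⁻¹ • y) =
      (∫ w : Metric.sphere (0 : E3) 1, g w ∂(volume : Measure E3).toSphere) *
        ∫ r in Ioi (0 : ℝ), r ^ 2 * f r := by
  have h1 : ∫ y : E3, f ‖y‖ * g (‖y‖⁻¹ • y)
      = ∫ y : ({0}ᶜ : Set E3), f ‖(y : E3)‖ * g (‖(y : E3)‖⁻¹ • y) ∂(Measure.comap Subtype.val volume) := by
    rw [integral_subtype_comap (measurableSet_singleton _).compl
      fun y : E3 => f ‖y‖ * g (‖y‖⁻¹ • y), restrict_compl_singleton]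
  have h2 := (volume : Measure E3).measurePreserving_homeomorphUnitSphereProd.integral_comp
    (Homeomorph.measurableEmbedding _)
    fun z : Metric.sphere (0 : E3) 1 × Ioi (0 : ℝ) => g z.1 * f z.2
  rw [integral_prod_mul (fun w : Metric.sphere (0 : E3) 1 => g w)
    (fun r : Ioi (0 : ℝ) => f r)] at h2
  have h3 : ∫ r : Ioi (0 : ℝ), f r ∂(Measure.volumeIoiPow (Module.finrank ℝ E3 - 1))
      = ∫ r in Ioi (0 : ℝ), r ^ 2 * f r := by
    simp only [Measure.volumeIoiPow, ENNReal.ofReal]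
    rw [integral_withDensity_eq_integral_smul (by fun_prop),
      integral_subtype_comap measurableSet_Ioi
        fun a => Real.toNNReal (a ^ (Module.finrank ℝ E3 - 1)) • f a]
    refine setIntegral_congr_fun measurableSet_Ioi fun r hr => ?_
    simp only [finrank_euclideanSpace, Fintype.card_fin, Nat.add_one_sub_one]
    rw [NNReal.smul_def, Real.coe_toNNReal _ (pow_nonneg (le_of_lt hr) _), smul_eq_mul]
  rw [h1, ← h3, ← h2]
  refine integral_congr_ae (ae_of_all _ fun y => ?_)
  simp [mul_comm]

/-! ### The divergence of a field that is constant on rays -/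

/-- A function that is continuous away from the origin and vanishes outside a spherical shell is
integrable. -/
theorem integrable_of_shell {F : E3 → ℝ} (hF : ∀ y, y ≠ 0 → ContinuousAt F y)
    (h1 : ∀ y, ‖y‖ < 1 → F y = 0) (h3 : ∀ y, 3 < ‖y‖ → F y = 0) : Integrable F := by
  have hc : Continuous F := continuous_iff_continuousAt.2 fun y => by
    rcases eq_or_ne y 0 with rfl | hy
    · refine (continuousAt_const (y := (0 : ℝ))).congr ?_
      filter_upwards [Metric.ball_mem_nhds (0 : E3) one_pos] with z hz
      exact (h1 z (by simpa using hz)).symm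
    · exact hF y hy
  refine hc.integrable_of_hasCompactSupport
    (HasCompactSupport.intro (isCompact_closedBall (0 : E3) 3) fun y hy => h3 y ?_)
  simpa using hy

theorem trace_eq_sum_coord (A : E3 →L[ℝ] E3) :
    LinearMap.trace ℝ E3 (A : E3 →ₗ[ℝ] E3) = ∑ i, A (EuclideanSpace.single i 1) i := by
  rw [LinearMap.trace_eq_sum_inner _ (EuclideanSpace.basisFun (Fin 3) ℝ)]
  simp [EuclideanSpace.inner_single_left]

/-- The divergence theorem for a vector field that is constant on the rays from the origin, in a
form on the unit sphere: the field is integrated by parts against a radial test function, and both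
sides are written in polar coordinates. -/
theorem integral_trace_fderiv_sphere {V : E3 → E3} (hV : ∀ y, y ≠ 0 → ContDiffAt ℝ 1 V y)
    (hhom : ∀ r : ℝ, 0 < r → ∀ y, V (r • y) = V y) :
    ∫ w : Metric.sphere (0 : E3) 1, LinearMap.trace ℝ E3 (fderiv ℝ V w : E3 →ₗ[ℝ] E3)
        ∂(volume : Measure E3).toSphere
      = 2 * ∫ w : Metric.sphere (0 : E3) 1, ⟪V w, (w : E3)⟫ ∂(volume : Measure E3).toSphere := by
  let χ : ContDiffBump (2 : ℝ) := ⟨1 / 2, 1, by norm_num, by norm_num⟩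
  have hχ : ContDiff ℝ 1 χ := χ.contDiff
  have hχd : Differentiable ℝ χ := hχ.differentiable one_ne_zero
  have hχ0 : ∀ r : ℝ, r ≤ 1 ∨ 3 ≤ r → χ r = 0 := fun r hr => χ.zero_of_le_dist (by
    rw [Real.dist_eq]
    change (1 : ℝ) ≤ _
    rcases hr with hr | hr
    · rw [abs_of_nonpos (by linarith)]; linarith
    · rw [abs_of_nonneg (by linarith)]; linarith)
  set f : E3 → ℝ := fun y => χ ‖y‖ with hf
  have hf0 : ∀ y, ‖y‖ < 1 ∨ 3 < ‖y‖ → f =ᶠ[𝓝 y] 0 := by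
    rintro y (hy | hy)
    · filter_upwards [continuous_norm.continuousAt.eventually (gt_mem_nhds hy)] with z hz
      exact hχ0 _ (Or.inl (le_of_lt hz))
    · filter_upwards [continuous_norm.continuousAt.eventually (lt_mem_nhds hy)] with z hz
      exact hχ0 _ (Or.inr (le_of_lt hz))
  have hf0' : ∀ y, ‖y‖ < 1 ∨ 3 < ‖y‖ → fderiv ℝ f y = 0 := fun y hy => by
    rw [(hf0 y hy).fderiv_eq]; simp
  have hfc : ∀ y, ContDiffAt ℝ 1 f y := fun y => by
    rcases eq_or_ne y 0 with rfl | hy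
    · exact contDiffAt_const.congr_of_eventuallyEq (hf0 0 (by simp))
    · exact hχ.contDiffAt.comp y (contDiffAt_norm ℝ hy)
  have hfd : ∀ y, DifferentiableAt ℝ f y := fun y => (hfc y).differentiableAt one_ne_zero
  have hfdc : ∀ y, ContinuousAt (fderiv ℝ f) y := fun y =>
    ((hfc y).fderiv_right (m := 0) (by norm_num)).continuousAt
  have hVd : ∀ y, y ≠ 0 → DifferentiableAt ℝ V y := fun y hy =>
    (hV y hy).differentiableAt one_ne_zero
  have hVdc : ∀ y, y ≠ 0 → ContinuousAt (fderiv ℝ V) y := fun y hy =>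
    ((hV y hy).fderiv_right (m := 0) (by norm_num)).continuousAt
  have hproj : ∀ (i : Fin 3) (y : E3), y ≠ 0 →
      HasFDerivAt (fun y => V y i) ((EuclideanSpace.proj i : E3 →L[ℝ] ℝ) ∘L fderiv ℝ V y) y :=
    fun i y hy => (EuclideanSpace.proj i : E3 →L[ℝ] ℝ).hasFDerivAt.comp y (hVd y hy).hasFDerivAt
  have hproj' : ∀ (i : Fin 3) (y v : E3), y ≠ 0 →
      fderiv ℝ (fun y => V y i) y v = fderiv ℝ V y v i := fun i y v hy => by
    rw [(hproj i y hy).fderiv]; rfl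
  -- integrability of the terms in the integration by parts
  have hcoord : ∀ (i : Fin 3) {G : E3 → E3} {y : E3}, ContinuousAt G y →
      ContinuousAt (fun z => G z i) y := fun i G y hG =>
    (EuclideanSpace.proj i : E3 →L[ℝ] ℝ).continuous.continuousAt.comp hG
  have hI1 : ∀ i : Fin 3,
      Integrable fun y => fderiv ℝ f y (EuclideanSpace.single i 1) * V y i := fun i => by
    refine integrable_of_shell (fun y hy => ?_) (fun y hy => ?_) (fun y hy => ?_)
    · exact ((hfdc y).clm_apply continuousAt_const).mul (hcoord i (hV y hy).continuousAt)
    · rw [hf0' y (Or.inl hy)]; simp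
    · rw [hf0' y (Or.inr hy)]; simp
  have hI2' : ∀ i : Fin 3,
      Integrable fun y => f y * fderiv ℝ V y (EuclideanSpace.single i 1) i := fun i => by
    refine integrable_of_shell (fun y hy => ?_) (fun y hy => ?_) (fun y hy => ?_)
    · exact (hfc y).continuousAt.mul (hcoord i ((hVdc y hy).clm_apply continuousAt_const))
    · rw [(hf0 y (Or.inl hy)).self_of_nhds]; simp
    · rw [(hf0 y (Or.inr hy)).self_of_nhds]; simp
  have hfz : f 0 = 0 := (hf0 0 (by simp)).self_of_nhds
  have hcongr : ∀ i : Fin 3, (fun y => f y * fderiv ℝ (fun y => V y i) y (EuclideanSpace.single i 1))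
      = fun y => f y * fderiv ℝ V y (EuclideanSpace.single i 1) i := fun i => by
    ext y
    rcases eq_or_ne y 0 with rfl | hy
    · rw [hfz, zero_mul, zero_mul]
    · rw [hproj' i y _ hy]
  have hI3 : ∀ i : Fin 3, Integrable fun y => f y * V y i := fun i => by
    refine integrable_of_shell (fun y hy => ?_) (fun y hy => ?_) (fun y hy => ?_)
    · exact (hfc y).continuousAt.mul (hcoord i (hV y hy).continuousAt)
    · rw [(hf0 y (Or.inl hy)).self_of_nhds]; simp
    · rw [(hf0 y (Or.inr hy)).self_of_nhds]; simp
  have hparts : ∀ i : Fin 3, ∫ y, f y * fderiv ℝ V y (EuclideanSpace.single i 1) i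
      = - ∫ y, fderiv ℝ f y (EuclideanSpace.single i 1) * V y i := fun i => by
    have h := integral_mul_fderiv_eq_neg_fderiv_mul_of_integrable (μ := (volume : Measure E3))
      (f := f) (g := fun y => V y i) (v := EuclideanSpace.single i 1) (hI1 i)
      (by rw [hcongr i]; exact hI2' i) (hI3 i) (fun y _ => hfd y) (fun y hy => by
        refine (hproj i y ?_).differentiableAt
        rintro rfl
        exact notMem_tsupport_iff_eventuallyEq.2 (hf0 0 (by simp)) hy)
    rwa [hcongr i] at h
  have hdiv : ∫ y, f y * LinearMap.trace ℝ E3 (fderiv ℝ V y : E3 →ₗ[ℝ] E3)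
      = - ∫ y, fderiv ℝ f y (V y) := by
    have h1 : ∀ y, fderiv ℝ f y (V y)
        = ∑ i, fderiv ℝ f y (EuclideanSpace.single i 1) * V y i := fun y => by
      conv_lhs => rw [← (EuclideanSpace.basisFun (Fin 3) ℝ).sum_repr (V y)]
      simp [map_sum, mul_comm]
    simp only [h1, trace_eq_sum_coord, Finset.mul_sum]
    rw [integral_finsetSum _ fun i _ => hI2' i, integral_finsetSum _ fun i _ => hI1 i,
      ← Finset.sum_neg_distrib]
    exact Finset.sum_congr rfl fun i _ => hparts i
  -- both sides in polar coordinates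
  have hleft : ∀ y, f y * LinearMap.trace ℝ E3 (fderiv ℝ V y : E3 →ₗ[ℝ] E3)
      = (fun r => χ r * r⁻¹) ‖y‖ *
        (fun w => LinearMap.trace ℝ E3 (fderiv ℝ V w : E3 →ₗ[ℝ] E3)) (‖y‖⁻¹ • y) := fun y => by
    rcases eq_or_ne y 0 with rfl | hy
    · rw [hfz]; simp
    have hr : 0 < ‖y‖⁻¹ := inv_pos.2 (norm_pos_iff.2 hy)
    have h1 : HasFDerivAt (fun z : E3 => V (‖y‖⁻¹ • z)) _ y :=
      HasFDerivAt.comp y (hVd (‖y‖⁻¹ • y) (smul_ne_zero hr.ne' hy)).hasFDerivAt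
        ((hasFDerivAt_id y).const_smul ‖y‖⁻¹)
    simp only [hhom _ hr] at h1
    have h2 : fderiv ℝ V y = ‖y‖⁻¹ • fderiv ℝ V (‖y‖⁻¹ • y) := by
      rw [h1.fderiv]; ext v; simp
    have h3 : LinearMap.trace ℝ E3 (fderiv ℝ V y : E3 →ₗ[ℝ] E3)
        = ‖y‖⁻¹ * LinearMap.trace ℝ E3 (fderiv ℝ V (‖y‖⁻¹ • y) : E3 →ₗ[ℝ] E3) := by
      rw [h2]; simp
    rw [h3]
    simp only [hf]
    ring
  have hright : ∀ y, fderiv ℝ f y (V y)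
      = deriv χ ‖y‖ * (fun w => ⟪V w, w⟫) (‖y‖⁻¹ • y) := fun y => by
    rcases eq_or_ne y 0 with rfl | hy
    · rw [hf0' 0 (by simp)]; simp
    have h0 : 0 < ‖y‖ := norm_pos_iff.2 hy
    have h1 : HasFDerivAt (fun z : E3 => ‖z‖) (‖y‖⁻¹ • innerSL ℝ y) y := by
      have h2 := (hasStrictFDerivAt_norm_sq y).hasFDerivAt.sqrt (by positivity)
      simp only [Real.sqrt_sq (norm_nonneg _)] at h2
      refine h2.congr_fderiv ?_
      ext v
      simp
      field_simp
    have h2 := (hχd ‖y‖).hasDerivAt.comp_hasFDerivAt y h1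
    have h3 : fderiv ℝ f y = deriv χ ‖y‖ • (‖y‖⁻¹ • innerSL ℝ y) := h2.fderiv
    rw [h3]
    simp only [hhom _ (inv_pos.2 h0), smul_apply, innerSL_apply_apply, smul_eq_mul,
      real_inner_smul_right, real_inner_comm]
  simp only [hleft, hright] at hdiv
  have hpl := integral_norm_mul_eq_integral_sphere (fun r => χ r * r⁻¹)
    fun w => LinearMap.trace ℝ E3 (fderiv ℝ V w : E3 →ₗ[ℝ] E3)
  have hpr := integral_norm_mul_eq_integral_sphere (deriv χ) fun w => ⟪V w, w⟫
  rw [hpl, hpr] at hdiv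
  -- the radial integrals
  have hcs : HasCompactSupport χ := χ.hasCompactSupport
  have hd : Continuous (deriv χ) := hχ.continuous_deriv le_rfl
  have hr1 : ∫ r in Ioi (0 : ℝ), r ^ 2 * (χ r * r⁻¹) = ∫ r, r * χ r := by
    have h : ∫ r in Ioi (0 : ℝ), r * χ r = ∫ r, r * χ r :=
      setIntegral_eq_integral_of_forall_compl_eq_zero fun r hr => by
        rw [hχ0 r (Or.inl (by simp only [mem_Ioi, not_lt] at hr; linarith)), mul_zero]
    rw [← h]
    refine setIntegral_congr_fun measurableSet_Ioi fun r hr => ?_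
    have : r ≠ 0 := ne_of_gt hr
    field_simp
  have hr2 : ∫ r in Ioi (0 : ℝ), r ^ 2 * deriv χ r = - (2 * ∫ r, r * χ r) := by
    rw [setIntegral_eq_integral_of_forall_compl_eq_zero fun r hr => by
      have : χ =ᶠ[𝓝 r] 0 := by
        simp only [mem_Ioi, not_lt] at hr
        filter_upwards [gt_mem_nhds (show r < 1 by linarith)] with s hs
        exact hχ0 s (Or.inl hs.le)
      rw [this.deriv_eq]; simp]
    have h := integral_mul_deriv_eq_deriv_mul_of_integrable (u := fun r : ℝ => r ^ 2) (v := χ)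
      (u' := fun r => 2 * r) (v' := deriv χ) (fun r _ => by simpa using hasDerivAt_pow 2 r)
      (fun r _ => (hχd r).hasDerivAt)
      (((continuous_pow 2).mul hd).integrable_of_hasCompactSupport hcs.deriv.mul_left)
      (((continuous_const.mul continuous_id).mul
        hχ.continuous).integrable_of_hasCompactSupport hcs.mul_left)
      (((continuous_pow 2).mul hχ.continuous).integrable_of_hasCompactSupport hcs.mul_left)
    rw [h, ← integral_const_mul]
    simp only [mul_assoc]
  have hpos : 0 < ∫ r, r * χ r := by
    refine (continuous_id.mul hχ.continuous).integral_pos_of_hasCompactSupport_nonneg_nonzero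
      (x := 2) hcs.mul_left (fun r => ?_) ?_
    · rcases le_total r 1 with hr | hr
      · simp [hχ0 r (Or.inl hr)]
      · exact mul_nonneg (zero_le_one.trans hr) χ.nonneg
    · have : χ 2 = 1 := χ.one_of_mem_closedBall (by simp [χ])
      simp [this]
  rw [hr1, hr2] at hdiv
  have h4 : (∫ w : Metric.sphere (0 : E3) 1, LinearMap.trace ℝ E3 (fderiv ℝ V w : E3 →ₗ[ℝ] E3)
      ∂(volume : Measure E3).toSphere) * (∫ r, r * χ r)
      = (2 * ∫ w : Metric.sphere (0 : E3) 1, ⟪V w, (w : E3)⟫ ∂(volume : Measure E3).toSphere) *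
        ∫ r, r * χ r := by
    rw [hdiv]; ring
  exact mul_right_cancel₀ hpos.ne' h4

end

section

/-! ### The region bounded by a radial graph -/

variable {P : E3 → ℝ} {E : Set E3}

/-- The gauge of the star-shaped set bounded by the radial graph `{P(w) w : ‖w‖ = 1}` of a function
`P`; its value at the origin is `0`. -/
noncomputable def radialGauge (P : E3 → ℝ) (y : E3) : ℝ :=
  ‖y‖ / P (‖y‖⁻¹ • y)

theorem radialGauge_smul {r : ℝ} (hr : 0 < r) (y : E3) :
    radialGauge P (r • y) = r * radialGauge P y := by
  have h : ‖r • y‖⁻¹ • r • y = ‖y‖⁻¹ • y := by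
    rw [norm_smul, Real.norm_of_nonneg hr.le, smul_smul, mul_inv_rev, mul_assoc,
      inv_mul_cancel₀ hr.ne', mul_one]
  rw [radialGauge, radialGauge, h, norm_smul, Real.norm_of_nonneg hr.le, mul_div_assoc]

theorem radialGauge_of_norm_eq_one {w : E3} (hw : ‖w‖ = 1) : radialGauge P w = (P w)⁻¹ := by
  simp [radialGauge, hw]

theorem continuous_radialGauge (hP : ContinuousOn P (Metric.sphere 0 1))
    (hpos : ∀ w, ‖w‖ = 1 → 0 < P w) : Continuous (radialGauge P) := by
  refine continuous_iff_continuousAt.2 fun y => ?_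
  rcases eq_or_ne y 0 with rfl | hy
  · obtain ⟨m, hm, hmP⟩ : ∃ m : ℝ, 0 < m ∧ ∀ w, ‖w‖ = 1 → m ≤ P w := by
      obtain ⟨w₀, hw₀, hmin⟩ := (isCompact_sphere (0 : E3) 1).exists_isMinOn
        (NormedSpace.sphere_nonempty.2 zero_le_one) hP
      exact ⟨P w₀, hpos w₀ (by simpa using hw₀), fun w hw => hmin (by simpa using hw)⟩
    have h0 : radialGauge P 0 = 0 := by simp [radialGauge]
    rw [ContinuousAt, h0]
    refine squeeze_zero_norm (a := fun z => ‖z‖ / m) (fun z => ?_) ?_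
    · rcases eq_or_ne z 0 with rfl | hz
      · simp [h0]
      · have h1 := hmP _ (norm_inv_norm_smul hz)
        rw [radialGauge, norm_div, norm_norm, Real.norm_of_nonneg (hm.le.trans h1)]
        gcongr
    · have h : Continuous fun z : E3 => ‖z‖ / m := by fun_prop
      simpa using h.tendsto 0
  · have h1 : ContinuousOn (fun z : E3 => ‖z‖⁻¹ • z) {0}ᶜ := by
      refine ContinuousOn.smul (ContinuousOn.inv₀ continuous_norm.continuousOn fun z hz => ?_) continuousOn_id
      exact norm_ne_zero_iff.2 hz
    have h2 : ContinuousOn (radialGauge P) {0}ᶜ := by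
      refine ContinuousOn.div continuous_norm.continuousOn (hP.comp h1 fun z hz => ?_) fun z hz => ?_
      · simpa using norm_inv_norm_smul hz
      · exact (hpos _ (norm_inv_norm_smul hz)).ne'
    exact h2.continuousAt (isOpen_compl_singleton.mem_nhds hy)

theorem image_smul_sphere_eq (hpos : ∀ w, ‖w‖ = 1 → 0 < P w) :
    (fun w : E3 => P w • w) '' Metric.sphere 0 1 = {y | radialGauge P y = 1} := by
  ext y
  constructor
  · rintro ⟨w, hw, rfl⟩
    have hw : ‖w‖ = 1 := by simpa using hw
    change radialGauge P (P w • w) = 1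
    rw [radialGauge_smul (hpos w hw), radialGauge_of_norm_eq_one hw,
      mul_inv_cancel₀ (hpos w hw).ne']
  · intro (h : radialGauge P y = 1)
    have hy : y ≠ 0 := by
      rintro rfl
      simp [radialGauge] at h
    have h1 := hpos _ (norm_inv_norm_smul hy)
    refine ⟨‖y‖⁻¹ • y, by simpa using norm_inv_norm_smul hy, ?_⟩
    rw [radialGauge, div_eq_one_iff_eq h1.ne'] at h
    simp only
    rw [← h, smul_smul, mul_inv_cancel₀ (norm_ne_zero_iff.2 hy), one_smul]

theorem region_image_smul_sphere (hP : ContinuousOn P (Metric.sphere 0 1))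
    (hpos : ∀ w, ‖w‖ = 1 → 0 < P w) :
    region ((fun w : E3 => P w • w) '' Metric.sphere 0 1) = {y | radialGauge P y < 1} := by
  rw [image_smul_sphere_eq hpos]
  have hc := continuous_radialGauge hP hpos
  apply Subset.antisymm
  · intro y hy
    by_contra h
    have h1 : 1 < radialGauge P y := lt_of_le_of_ne (not_lt.1 h) (Ne.symm hy.1)
    have hy0 : y ≠ 0 := by
      rintro rfl
      simp [radialGauge] at h
    refine notMem_region_of_ray hy0 (fun s hs => ?_) hy
    change ¬ radialGauge P (y + s • y) = 1
    have h2 : y + s • y = (1 + s) • y := by module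
    rw [h2, radialGauge_smul (by linarith)]
    nlinarith
  · intro y (hy : radialGauge P y < 1)
    refine ⟨hy.ne, ?_⟩
    obtain ⟨M, hM⟩ := (isCompact_sphere (0 : E3) 1).exists_bound_of_continuousOn hP
    refine (Metric.isBounded_closedBall (x := (0 : E3)) (r := M)).subset fun z hz => ?_
    have hz1 : radialGauge P z < 1 := by
      by_contra! h
      obtain ⟨p, hp, hp1⟩ := isPreconnected_connectedComponentIn.intermediate_value
        (mem_connectedComponentIn (show y ∈ {y | radialGauge P y = 1}ᶜ from hy.ne)) hz
        hc.continuousOn ⟨hy.le, h⟩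
      exact connectedComponentIn_subset _ _ hp hp1
    rw [mem_closedBall_zero_iff]
    rcases eq_or_ne z 0 with rfl | hz0
    · obtain ⟨w, hw⟩ := NormedSpace.sphere_nonempty (x := (0 : E3)) (r := 1) |>.2 zero_le_one
      simpa using (norm_nonneg _).trans (hM w hw)
    · have h1 := norm_inv_norm_smul hz0
      rw [radialGauge, div_lt_one (hpos _ h1)] at hz1
      exact hz1.le.trans ((le_abs_self _).trans (hM _ (by simpa using h1)))

/-- The integral of `1 / ‖y‖²` over the region bounded by a radial graph, in polar coordinates. -/
theorem integral_region_image_smul_sphere (hP : ContinuousOn P (Metric.sphere 0 1))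
    (hpos : ∀ w, ‖w‖ = 1 → 0 < P w) :
    IntegrableOn (fun y : E3 => 1 / ‖y‖ ^ 2)
      (region ((fun w : E3 => P w • w) '' Metric.sphere 0 1)) ∧
    ∫ y in region ((fun w : E3 => P w • w) '' Metric.sphere 0 1), 1 / ‖y‖ ^ 2 =
      ∫ w : Metric.sphere (0 : E3) 1, P w ∂(volume : Measure E3).toSphere := by
  rw [region_image_smul_sphere hP hpos]
  have hmeas : MeasurableSet {y | radialGauge P y < 1} :=
    (isOpen_lt (continuous_radialGauge hP hpos) continuous_const).measurableSet
  have hPc : Continuous fun w : Metric.sphere (0 : E3) 1 => P w := hP.domRestrict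
  have hPi : Integrable (fun w : Metric.sphere (0 : E3) 1 => P w) (volume : Measure E3).toSphere :=
    hPc.integrable_of_hasCompactSupport (HasCompactSupport.of_compactSpace _)
  have hP0 : ∀ w : Metric.sphere (0 : E3) 1, 0 ≤ P w := fun w => (hpos _ (by simp)).le
  have hf : Measurable fun y : E3 => 1 / ‖y‖ ^ 2 := by fun_prop
  have hlint : ∫⁻ y in {y | radialGauge P y < 1}, ENNReal.ofReal (1 / ‖y‖ ^ 2)
      = ENNReal.ofReal (∫ w : Metric.sphere (0 : E3) 1, P w ∂(volume : Measure E3).toSphere) := by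
    rw [← lintegral_indicator hmeas,
      lintegral_eq_lintegral_sphere (hf.ennreal_ofReal.indicator hmeas),
      ofReal_integral_eq_lintegral_ofReal hPi (ae_of_all _ hP0)]
    refine lintegral_congr fun w => ?_
    have hw : ‖(w : E3)‖ = 1 := by simp
    have h1 : ∀ r ∈ Ioi (0 : ℝ), ENNReal.ofReal (r ^ 2) *
        {y | radialGauge P y < 1}.indicator (fun y => ENNReal.ofReal (1 / ‖y‖ ^ 2)) (r • (w : E3))
        = (Iio (P w)).indicator 1 r := fun r (hr : 0 < r) => by
      have h2 : r • (w : E3) ∈ {y | radialGauge P y < 1} ↔ r ∈ Iio (P w) := by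
        change radialGauge P (r • (w : E3)) < 1 ↔ r < P w
        rw [radialGauge_smul hr, radialGauge_of_norm_eq_one hw, ← div_eq_mul_inv,
          div_lt_one (hpos _ hw)]
      by_cases h3 : r ∈ Iio (P w)
      · rw [indicator_of_mem (h2.2 h3), indicator_of_mem h3, ← ENNReal.ofReal_mul (by positivity),
          norm_smul, hw, mul_one, Real.norm_of_nonneg hr.le, mul_one_div_cancel (by positivity)]
        simp
      · rw [indicator_of_notMem (fun h => h3 (h2.1 h)), indicator_of_notMem h3, mul_zero]
    rw [setLIntegral_congr_fun measurableSet_Ioi h1, lintegral_indicator_one measurableSet_Iio,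
      Measure.restrict_apply measurableSet_Iio, inter_comm, Ioi_inter_Iio, Real.volume_Ioo, sub_zero]
  have hnn : ∀ y : E3, 0 ≤ 1 / ‖y‖ ^ 2 := fun y => by positivity
  refine ⟨(lintegral_ofReal_ne_top_iff_integrable hf.aestronglyMeasurable
    (ae_of_all _ hnn)).1 (hlint ▸ ENNReal.ofReal_ne_top), ?_⟩
  rw [integral_eq_lintegral_of_nonneg_ae (ae_of_all _ hnn) hf.aestronglyMeasurable, hlint,
    ENNReal.toReal_ofReal (integral_nonneg hP0)]

/-! ### The total mean curvature -/

namespace IsOvaloid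

theorem support_pos (hE : IsOvaloid E) (ho : 0 ∈ region E) {w : E3} (hw : ‖w‖ = 1) :
    0 < support E 0 w := by
  have hw0 : w ≠ 0 := by rw [← norm_ne_zero_iff, hw]; exact one_ne_zero
  obtain ⟨s, hs, hsE⟩ : ∃ s : ℝ, 0 ≤ s ∧ s • w ∈ E := by
    by_contra! h
    exact notMem_region_of_ray hw0 (fun s hs => by simpa using h s hs) ho
  have hs0 : s ≠ 0 := by
    rintro rfl
    exact ho.1 (by simpa using hsE)
  rw [hE.support_eq hw]
  have h := hE.inner_le_inner_gaussInv hw hsE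
  rw [real_inner_smul_left, real_inner_self_eq_norm_sq, hw] at h
  have : 0 < s := lt_of_le_of_ne hs hs0.symm
  linarith

theorem continuousOn_support (hE : IsOvaloid E) :
    ContinuousOn (support E 0) (Metric.sphere 0 1) :=
  (hE.continuousOn_gaussInv.inner continuousOn_id).congr fun _ hw =>
    hE.support_eq (by simpa using hw)

/-- The ratio `2H / K` of the curvatures, pulled back to the sphere by the inverse of the Gauss map,
is the divergence of the homogeneous extension of that inverse. -/
theorem meanCurvature_div_gaussianCurvature (hE : IsOvaloid E) {w : E3} (hw : ‖w‖ = 1) :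
    meanCurvature E (gaussInv E w) / gaussianCurvature E (gaussInv E w) =
      LinearMap.trace ℝ E3 (fderiv ℝ (gaussInvExt E) w : E3 →ₗ[ℝ] E3) / 2 := by
  obtain ⟨hx, hN⟩ := hE.gaussInv_spec hw
  have h := hE.gaussianCurvature_mul_trace hx one_pos
  rw [hN, one_smul, inv_one, one_mul] at h
  have hK := hE.gaussianCurvature_pos _ hx
  field_simp
  linarith

theorem continuous_trace_fderiv_gaussInvExt (hE : IsOvaloid E) :
    Continuous fun w : Metric.sphere (0 : E3) 1 =>
      LinearMap.trace ℝ E3 (fderiv ℝ (gaussInvExt E) w : E3 →ₗ[ℝ] E3) := by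
  refine continuous_iff_continuousAt.2 fun w => ?_
  have hw : (w : E3) ≠ 0 := by rw [← norm_ne_zero_iff]; simp
  have h1 : ContinuousAt (fderiv ℝ (gaussInvExt E)) w :=
    ((hE.contDiffAt_gaussInvExt hw).fderiv_right (m := 0) (by norm_num)).continuousAt
  have h2 : Continuous fun A : E3 →L[ℝ] E3 => LinearMap.trace ℝ E3 (A : E3 →ₗ[ℝ] E3) := by
    simp only [trace_eq_sum_coord]
    fun_prop
  exact h2.continuousAt.comp (h1.comp continuous_subtype_val.continuousAt)

theorem integral_meanCurvature (hE : IsOvaloid E) :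
    IntegrableOn (meanCurvature E) E (Measure.euclideanHausdorffMeasure 2) ∧
    ∫ x in E, meanCurvature E x ∂(Measure.euclideanHausdorffMeasure 2) =
      ∫ w : Metric.sphere (0 : E3) 1, support E 0 w ∂(volume : Measure E3).toSphere := by
  have hemb : MeasurableEmbedding fun w : Metric.sphere (0 : E3) 1 => gaussInv E w := by
    refine (hE.continuous_gaussInv.isClosedEmbedding fun w₁ w₂ h => ?_).measurableEmbedding
    have h1 := (hE.gaussInv_spec (w := w₁) (by simp)).2
    have h2 := (hE.gaussInv_spec (w := w₂) (by simp)).2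
    exact Subtype.ext (by rw [← h1, h, h2])
  have hratio : ∀ w : Metric.sphere (0 : E3) 1,
      meanCurvature E (gaussInv E w) / gaussianCurvature E (gaussInv E w) =
      LinearMap.trace ℝ E3 (fderiv ℝ (gaussInvExt E) w : E3 →ₗ[ℝ] E3) / 2 := fun w =>
    hE.meanCurvature_div_gaussianCurvature (by simp)
  have hK : AEMeasurable (fun y => ENNReal.ofReal (gaussianCurvature E y))
      ((Measure.euclideanHausdorffMeasure 2).restrict E) :=
    (hE.continuousOn_gaussianCurvature.aemeasurable hE.isCompact.measurableSet).ennreal_ofReal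
  have hKtop : ∀ᵐ y ∂((Measure.euclideanHausdorffMeasure 2).restrict E),
      ENNReal.ofReal (gaussianCurvature E y) < ⊤ := ae_of_all _ fun _ => ENNReal.ofReal_lt_top
  have hcancel : (fun y => (ENNReal.ofReal (gaussianCurvature E y)).toReal •
      (meanCurvature E y / gaussianCurvature E y))
      =ᵐ[(Measure.euclideanHausdorffMeasure 2).restrict E] meanCurvature E := by
    filter_upwards [ae_restrict_mem hE.isCompact.measurableSet] with y hy
    have h := hE.gaussianCurvature_pos y hy
    rw [ENNReal.toReal_ofReal h.le, smul_eq_mul, mul_div_cancel₀ _ h.ne']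
  constructor
  · have h1 : Integrable (fun y => meanCurvature E y / gaussianCurvature E y)
        (gaussMeasure E) := by
      rw [gaussMeasure, hemb.integrable_map_iff]
      refine Integrable.congr ?_ (ae_of_all _ fun w => (hratio w).symm)
      exact (hE.continuous_trace_fderiv_gaussInvExt.div_const 2).integrable_of_hasCompactSupport
        (HasCompactSupport.of_compactSpace _)
    rw [hE.gaussMeasure_eq, integrable_withDensity_iff_integrable_smul₀' hK hKtop] at h1
    exact h1.congr hcancel
  · rw [← integral_congr_ae hcancel, ← integral_withDensity_eq_integral_toReal_smul₀ hK hKtop,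
      ← hE.gaussMeasure_eq, gaussMeasure, hemb.integral_map, integral_congr_ae
        (ae_of_all _ hratio), integral_div, integral_trace_fderiv_sphere
        (fun y hy => hE.contDiffAt_gaussInvExt hy) (fun r hr y => gaussInvExt_smul hr y),
      mul_div_cancel_left₀ _ two_ne_zero]
    refine integral_congr_ae (ae_of_all _ fun w => ?_)
    simp only
    rw [hE.support_eq (by simp), gaussInvExt_of_norm_eq_one (by simp)]

end IsOvaloid

end

end Ovaloid

/-- The total mean curvature of an ovaloid `E` with the origin inside is the integral of `1 / ‖y‖²`
over the region bounded by the pedal surface of `E` with respect to the origin. The area element of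
`E` is the two-dimensional Euclidean Hausdorff measure. -/
theorem theorem1 (E : Set Ovaloid.E3) (hE : Ovaloid.IsOvaloid E) (ho : 0 ∈ Ovaloid.region E) :
    IntegrableOn (Ovaloid.meanCurvature E) E (Measure.euclideanHausdorffMeasure 2) ∧
    IntegrableOn (fun y : Ovaloid.E3 => 1 / ‖y‖ ^ 2)
      (Ovaloid.region (Ovaloid.pedalSurface E 0)) volume ∧
    ∫ x in E, Ovaloid.meanCurvature E x ∂(Measure.euclideanHausdorffMeasure 2) =
      ∫ y in Ovaloid.region (Ovaloid.pedalSurface E 0), 1 / ‖y‖ ^ 2 := by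
  have h1 := hE.integral_meanCurvature
  have h2 := Ovaloid.integral_region_image_smul_sphere hE.continuousOn_support
    fun w hw => hE.support_pos ho hw
  have h3 : Ovaloid.pedalSurface E 0
      = (fun w : Ovaloid.E3 => Ovaloid.support E 0 w • w) '' Metric.sphere 0 1 := by
    simp [Ovaloid.pedalSurface]
  rw [h3]
  exact ⟨h1.1, h2.1, h1.2.trans h2.2.symm⟩
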